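/- Let $\mathcal N$ be a set of $n\ge 1$ agents and $\mathcal D$ a finite non-empty set of alternatives. A smart ballot of agent $a$ is a ranked list $B_a=(B_a^1>\dots>B_a^{k}>x)$ with $k\ge 0$, in which each $B_a^h=(S_a^h,F_a^h)$ is a delegation, given by a set $S_a^h\subseteq\mathcal N$ and a function $F_a^h:\mathcal D^{S_a^h}\to\mathcal D$, and the last level $B_a^{k+1}=x\in\mathcal D$ is a direct backup vote. The ballot is in the language Liquid if each of its delegations is of the form $(\{b\},\mathrm{id})$ with $b\in\mathcal N\setminus\{a\}$. A profile $\boldsymbol B$ consists of one ballot for each agent; it is in Liquid if all its ballots are. A certificate for $\boldsymbol B$ is a vector $\mathbf c\in\mathbb N^{\mathcal N}$ such that each $\mathbf c_a$ is a preference level of $B_a$, i.e. $1\le \mathbf c_a\le k_a+1$, where $k_a$ is the number of delegations in $B_a$. It is consistent if the agents can be ordered in such a way that the level $B_a^{\mathbf c_a}$ of each agent $a$ determines a vote $X_a$ from the votes $X_b$ of the agents $b$ that precede $a$: either $B_a^{\mathbf c_a}$ is the direct vote $X_a$, or it is a delegation $(S,F)$ and $F$ takes the value $X_a$ on all completions of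 these votes to a vector in $\mathcal D^{S}$ (that is, $X_a$ is a necessary winner). The resulting vector $X_{\mathbf c}=(X_a)_{a\in\mathcal N}$ depends only on $\mathbf c$. Let $\mathcal C(\boldsymbol B)$ be the set of consistent certificates of $\boldsymbol B$, let $\mathrm{rank}(\mathbf c)=\sum_{a\in\mathcal N}\mathbf c_a$, and let $$\mathrm{MinSum}(\boldsymbol B)=\Big\{X_{\mathbf c} \;\Big|\; \mathbf c\in\operatorname*{arg\,min}_{\mathbf c\in\mathcal C(\boldsymbol B)}\mathrm{rank}(\mathbf c)\Big\}.$$ Theorem. There are a program for a random access machine with uniform cost (every elementary instruction takes one time step; the arithmetic instructions are increment and truncated subtraction, and memory is addressed indirectly) and a constant $C$ such that, for all $n\ge 1$, all $\mathcal D$ and every profile $\boldsymbol B$ in Liquid, the program, started on the list of ballots of $\boldsymbol B$ (agents and alternatives being written as numbers), halts after at most $C\,n(d+n)$ time steps with an outcome $X\in\mathrm{MinSum}(\boldsymbol B)$ in its memory, where $d$ is the total number of delegations in $\boldsymbol B$. That is, an outcome in $\mathrm{MinSum}(\boldsymbol B)$ can be found in $\mathcal O(n(d+n))$ time. -/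

import Mathlib

/-! ### Smart voting: ballots, certificates and the MinSum unravelling -/

namespace SmartVoting

/-- A delegation `(S, F)`: a finite set `S` of agents together with a resolute aggregation
function `F`, which turns the votes of the members of `S` into a single alternative. -/
structure Delegation (N D : Type) where
  S : Finset N
  F : ({b : N // b ∈ S} → D) → D

/-- The delegation `({b}, id)`: copy the vote of the single agent `b`. -/
def Delegation.single {N D : Type} (b : N) : Delegation N D where
  S := {b}
  F := fun v => v ⟨b, Finset.mem_singleton_self b⟩

/-- A smart ballot `((S¹, F¹) > ⋯ > (Sᵏ, Fᵏ) > x)` with `k ≥ 0`: a ranked list of delegations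
followed by a direct backup vote. -/
structure SmartBallot (N D : Type) where
  delegations : List (Delegation N D)
  backup : D

/-- A profile: one smart ballot for each agent. -/
abbrev Profile (N D : Type) : Type := N → SmartBallot N D

/-- The number of preference levels of a ballot: its delegations and the backup vote. -/
def SmartBallot.numLevels {N D : Type} (b : SmartBallot N D) : ℕ := b.delegations.length + 1

/-- The `h`-th preference level, `1 ≤ h ≤ numLevels`: a delegation for `h ≤ k` and the direct
backup vote for `h = k + 1`. -/
def SmartBallot.level {N D : Type} (b : SmartBallot N D) (h : ℕ) : Delegation N D ⊕ D :=
  match b.delegations[h - 1]? with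
  | some δ => Sum.inl δ
  | none => Sum.inr b.backup

/-- The ballot of agent `a` is in the language Liquid: each of its delegations is of the form
`({b}, id)` for some agent `b ≠ a`. -/
def SmartBallot.IsLiquid {N D : Type} (a : N) (b : SmartBallot N D) : Prop :=
  ∀ δ ∈ b.delegations, ∃ c : N, c ≠ a ∧ δ = Delegation.single c

/-- All the ballots of the profile are in the language Liquid. -/
def Profile.IsLiquid {N D : Type} (B : Profile N D) : Prop := ∀ a, (B a).IsLiquid a

/-- The number of delegations in a profile. -/
def Profile.numDelegations {N D : Type} [Fintype N] (B : Profile N D) : ℕ :=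
  ∑ a, (B a).delegations.length

/-- `x` is the necessary winner of the delegation `δ` on the partial vector of votes `X` (where
`none` is the placeholder `Δ`): `δ.F` takes the value `x` on all completions of `X`. -/
def Delegation.NecessaryWinner {N D : Type} (δ : Delegation N D) (X : N → Option D) (x : D) :
    Prop :=
  ∀ v : {b : N // b ∈ δ.S} → D, (∀ b y, X b.1 = some y → v b = y) → δ.F v = x

/-- A preference level determines the vote `x` from the partial vector of votes `X`: either it is
the direct vote `x`, or it is a delegation and its value on `X` is `x`. -/
def LevelDetermines {N D : Type} (l : Delegation N D ⊕ D) (X : N → Option D) (x : D) : Prop :=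
  match l with
  | Sum.inl δ => δ.NecessaryWinner X x
  | Sum.inr y => x = y

/-- A certificate picks one of the preference levels of each agent. -/
def IsCertificate {N D : Type} (B : Profile N D) (c : N → ℕ) : Prop :=
  ∀ a, 1 ≤ c a ∧ c a ≤ (B a).numLevels

/-- `X` is an outcome vector of the certificate `c`: for some ordering `σ` of the agents, the
levels chosen by `c` determine the votes in `X` one agent after the other, where the vote of `a`
is determined from the votes of the agents that precede `a` (all other entries of the vector are
still placeholders when `a` is treated). -/
def IsOutcomeOf {N D : Type} [Fintype N] (B : Profile N D) (c : N → ℕ) (X : N → D) : Prop :=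
  ∃ σ : N ≃ Fin (Fintype.card N), ∀ a,
    LevelDetermines ((B a).level (c a)) (fun b => if σ b < σ a then some (X b) else none) (X a)

/-- The set of the consistent certificates of `B`. -/
def consistentCertificates {N D : Type} [Fintype N] (B : Profile N D) : Set (N → ℕ) :=
  {c | IsCertificate B c ∧ ∃ X : N → D, IsOutcomeOf B c X}

/-- The rank of a certificate: the sum of the preference levels used. -/
def rank {N : Type} [Fintype N] (c : N → ℕ) : ℕ := ∑ a, c a

/-- `MinSum(B)`: the outcome vectors of the consistent certificates of minimum rank. -/
def MinSum {N D : Type} [Fintype N] (B : Profile N D) : Set (N → D) :=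
  {X | ∃ c ∈ consistentCertificates B,
    (∀ c' ∈ consistentCertificates B, rank c ≤ rank c') ∧ IsOutcomeOf B c X}

end SmartVoting

/-! ### A random access machine with uniform cost

The memory consists of registers and of arrays, all of whose cells hold natural numbers. A program
is a fixed finite text, so it refers to a fixed finite number of registers and arrays by name; the
cells of an array are addressed indirectly, through the contents of a register. Arithmetic is
restricted to increments and (truncated) subtractions, so that in `t` steps no number can exceed
the largest number in the input and in the program by more than `t`: the numbers that occur in a
run of polynomial length have logarithmically many bits, and unit cost per instruction is
realistic. -/

namespace RAM

/-- The contents of the memory: `reg x` is the content of register `x`, and `arr k i` is the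
content of cell `i` of array `k`. -/
structure Memory where
  reg : ℕ → ℕ
  arr : ℕ → ℕ → ℕ

/-- Register `x` is overwritten by `v`. -/
def Memory.setReg (M : Memory) (x v : ℕ) : Memory :=
  { M with reg := Function.update M.reg x v }

/-- Cell `i` of array `k` is overwritten by `v`. -/
def Memory.setCell (M : Memory) (k i v : ℕ) : Memory :=
  { M with arr := Function.update M.arr k (Function.update (M.arr k) i v) }

/-- Programs. The arguments `x y z` name registers, `k` names an array, `c` is a constant. -/
inductive Prog : Type
  /-- do nothing -/
  | skip : Prog
  /-- `x := c` -/
  | const (x c : ℕ) : Prog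
  /-- `x := y` -/
  | copy (x y : ℕ) : Prog
  /-- `x := y + 1` -/
  | succ (x y : ℕ) : Prog
  /-- `x := max (y - z) 0` -/
  | sub (x y z : ℕ) : Prog
  /-- `x := k[y]` -/
  | load (x k y : ℕ) : Prog
  /-- `k[x] := y` -/
  | store (k x y : ℕ) : Prog
  /-- first `p`, then `q` -/
  | seq (p q : Prog) : Prog
  /-- if `x ≠ 0` then `p` else `q` -/
  | ite (x : ℕ) (p q : Prog) : Prog
  /-- while `x ≠ 0` do `p` -/
  | loop (x : ℕ) (p : Prog) : Prog

/-- `Exec p M t M'`: started with memory `M`, the program `p` halts after exactly `t` steps, with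
memory `M'`. Each elementary instruction and each test of a register is one step. -/
inductive Exec : Prog → Memory → ℕ → Memory → Prop
  | skip (M : Memory) : Exec Prog.skip M 1 M
  | const (x c : ℕ) (M : Memory) : Exec (Prog.const x c) M 1 (M.setReg x c)
  | copy (x y : ℕ) (M : Memory) : Exec (Prog.copy x y) M 1 (M.setReg x (M.reg y))
  | succ (x y : ℕ) (M : Memory) : Exec (Prog.succ x y) M 1 (M.setReg x (M.reg y + 1))
  | sub (x y z : ℕ) (M : Memory) : Exec (Prog.sub x y z) M 1 (M.setReg x (M.reg y - M.reg z))
  | load (x k y : ℕ) (M : Memory) : Exec (Prog.load x k y) M 1 (M.setReg x (M.arr k (M.reg y)))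
  | store (k x y : ℕ) (M : Memory) :
      Exec (Prog.store k x y) M 1 (M.setCell k (M.reg x) (M.reg y))
  | seq {p q : Prog} {M₀ M₁ M₂ : Memory} {t₁ t₂ : ℕ} (h₁ : Exec p M₀ t₁ M₁)
      (h₂ : Exec q M₁ t₂ M₂) : Exec (Prog.seq p q) M₀ (t₁ + t₂) M₂
  | ite_true {x : ℕ} {p q : Prog} {M M' : Memory} {t : ℕ} (hx : M.reg x ≠ 0)
      (h : Exec p M t M') : Exec (Prog.ite x p q) M (1 + t) M'
  | ite_false {x : ℕ} {p q : Prog} {M M' : Memory} {t : ℕ} (hx : M.reg x = 0)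
      (h : Exec q M t M') : Exec (Prog.ite x p q) M (1 + t) M'
  | loop_done {x : ℕ} {p : Prog} {M : Memory} (hx : M.reg x = 0) : Exec (Prog.loop x p) M 1 M
  | loop_step {x : ℕ} {p : Prog} {M₀ M₁ M₂ : Memory} {t₁ t₂ : ℕ} (hx : M₀.reg x ≠ 0)
      (h₁ : Exec p M₀ t₁ M₁) (h₂ : Exec (Prog.loop x p) M₁ t₂ M₂) :
      Exec (Prog.loop x p) M₀ (1 + t₁ + t₂) M₂

/-- The machine is deterministic: a run has only one length and only one result. -/
theorem Exec.deterministic {p : Prog} {M M₁ : Memory} {t₁ : ℕ} (h₁ : Exec p M t₁ M₁) :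
    ∀ {t₂ : ℕ} {M₂ : Memory}, Exec p M t₂ M₂ → t₁ = t₂ ∧ M₁ = M₂ := by
  induction h₁ with
  | seq _ _ ih₁ ih₂ =>
    intro _ _ h
    cases h with
    | seq g₁ g₂ =>
      obtain ⟨rfl, rfl⟩ := ih₁ g₁
      obtain ⟨rfl, rfl⟩ := ih₂ g₂
      exact ⟨rfl, rfl⟩
  | ite_true hx _ ih =>
    intro _ _ h
    cases h with
    | ite_true _ g => obtain ⟨rfl, rfl⟩ := ih g; exact ⟨rfl, rfl⟩
    | ite_false gx _ => exact absurd gx hx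
  | ite_false hx _ ih =>
    intro _ _ h
    cases h with
    | ite_true gx _ => exact absurd hx gx
    | ite_false _ g => obtain ⟨rfl, rfl⟩ := ih g; exact ⟨rfl, rfl⟩
  | loop_done hx =>
    intro _ _ h
    cases h with
    | loop_done _ => exact ⟨rfl, rfl⟩
    | loop_step gx _ _ => exact absurd hx gx
  | loop_step hx _ _ ih₁ ih₂ =>
    intro _ _ h
    cases h with
    | loop_done gx => exact absurd gx hx
    | loop_step _ g₁ g₂ =>
      obtain ⟨rfl, rfl⟩ := ih₁ g₁
      obtain ⟨rfl, rfl⟩ := ih₂ g₂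
      exact ⟨rfl, rfl⟩
  | _ =>
    intro _ _ h
    cases h
    exact ⟨rfl, rfl⟩

/-- The initial memory on a given input: the input is in array `0`, all other cells are `0`. -/
def Memory.init (input : List ℕ) : Memory where
  reg := fun _ => 0
  arr := fun k i => if k = 0 then input.getD i 0 else 0

end RAM

/-! ### Liquid profiles as inputs

Agents are numbered `0, …, n - 1` and alternatives are numbered `0, …, m - 1`. -/

namespace SmartVoting

/-- A ballot is written as the number of its delegations, then its delegations from the most to
the least preferred, each as the list of its delegates (a single agent if the ballot is in Liquid,
where the function `id` need not be written down), then the backup vote. -/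
def SmartBallot.encode {n m : ℕ} (b : SmartBallot (Fin n) (Fin m)) : List ℕ :=
  b.delegations.length ::
    (b.delegations.flatMap (fun δ => (δ.S.sort (· ≤ ·)).map Fin.val) ++ [b.backup.val])

/-- A profile is written as the number of agents, followed by the ballots of the agents. -/
def Profile.encode {n m : ℕ} (B : Profile (Fin n) (Fin m)) : List ℕ :=
  n :: (List.finRange n).flatMap (fun a => (B a).encode)

/-- A vector of votes is stored in array `1`: its cell `a` holds the vote of agent `a`. -/
def StoresOutcome {n m : ℕ} (M : RAM.Memory) (X : Fin n → Fin m) : Prop :=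
  ∀ a : Fin n, M.arr 1 a.val = (X a).val

end SmartVoting

/-! The agents and an extra root are the vertices of a digraph. A delegation of `a` to `u` at level
`h` is an edge from `u` to `a` of weight `h`; the backup of `a` is an edge from the root of weight
`k + 1`, where `k` is the number of delegations of `a`. If there are two or more alternatives, a
delegation determines a vote only once its delegate has voted. So consistent certificates correspond
to spanning arborescences (`Tree.isOutcomeOf`, `IsOutcomeOf.exists_edges`), rank is weight, and a
minimum arborescence is wanted. With at most one alternative all outcomes coincide.

Optimality is linear programming duality. Dual values `y t` are put on nonempty vertex sets `S t`
without the root, so that for each edge the total value of the sets it enters is at most its weight.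
An arborescence enters each set, hence weighs at least the sum of the `y t`; equality holds if its
edges are tight and each set is entered only once (`Tree.weight_le`).

The first phase keeps a path of strongly connected components labelled `2, …, K`. Each step raises
the dual of the top component until an entering edge becomes tight, and records that edge. If its
tail is unvisited, the path grows (`Labelled.extend`); otherwise all labels above that of the tail
collapse to it (`Labelled.merge`). An edge entering the top component enters every earlier set that
contains its head (`Labelled.dual_eq`), so its reduced cost is `rem` of the head minus `sl`: one
number per vertex is maintained (`History.push`). The potential `2 * unvisited + K` bounds the steps
by `2 * n`, each costing one scan of the edges and a few of the vertices.

The second phase grows a tree from the root, always by the earliest recorded edge that leaves the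
reached set. This enters no `S s` twice (`Tree.step`): if `S s` is partly reached, edges recorded
before time `s` still cross the boundary of the reached set, so the earliest such edge precedes `s`,
and edges recorded before `s` do not enter `S s`. -/

/-! ### Total correctness with time bounds for the machine. -/

namespace RAM

/-- `Runs p M T Q`: started with `M`, the program `p` halts within `T` steps in a memory
satisfying `Q`. -/
def Runs (p : Prog) (M : Memory) (T : ℕ) (Q : Memory → Prop) : Prop :=
  ∃ t M', Exec p M t M' ∧ t ≤ T ∧ Q M'

theorem Runs.mono {p : Prog} {M : Memory} {T T' : ℕ} {Q Q' : Memory → Prop}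
    (h : Runs p M T Q) (hT : T ≤ T') (hQ : ∀ M', Q M' → Q' M') : Runs p M T' Q' := by
  obtain ⟨t, M', h₁, h₂, h₃⟩ := h
  exact ⟨t, M', h₁, h₂.trans hT, hQ _ h₃⟩

theorem Runs.seq {p q : Prog} {M : Memory} {T₁ T₂ : ℕ} {Q : Memory → Prop}
    (h : Runs p M T₁ (fun M' => Runs q M' T₂ Q)) : Runs (Prog.seq p q) M (T₁ + T₂) Q := by
  obtain ⟨t, M', h₁, h₂, t', M'', h₃, h₄, h₅⟩ := h
  exact ⟨t + t', M'', Exec.seq h₁ h₃, by omega, h₅⟩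

theorem Runs.seq' {p q : Prog} {M : Memory} {T₁ T₂ : ℕ} {R Q : Memory → Prop}
    (h₁ : Runs p M T₁ R) (h₂ : ∀ M', R M' → Runs q M' T₂ Q) :
    Runs (Prog.seq p q) M (T₁ + T₂) Q :=
  Runs.seq (h₁.mono le_rfl h₂)

theorem Runs.ite {x : ℕ} {p q : Prog} {M : Memory} {T : ℕ} {Q : Memory → Prop}
    (h₁ : M.reg x ≠ 0 → Runs p M T Q) (h₂ : M.reg x = 0 → Runs q M T Q) :
    Runs (Prog.ite x p q) M (1 + T) Q := by
  by_cases hx : M.reg x = 0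
  · obtain ⟨t, M', h, ht, hQ⟩ := h₂ hx
    exact ⟨1 + t, M', Exec.ite_false hx h, by omega, hQ⟩
  · obtain ⟨t, M', h, ht, hQ⟩ := h₁ hx
    exact ⟨1 + t, M', Exec.ite_true hx h, by omega, hQ⟩

theorem Runs.loop_done {x : ℕ} {p : Prog} {M : Memory} {Q : Memory → Prop}
    (hx : M.reg x = 0) (hQ : Q M) : Runs (Prog.loop x p) M 1 Q :=
  ⟨1, M, Exec.loop_done hx, le_rfl, hQ⟩

theorem Runs.loop_step {x : ℕ} {p : Prog} {M : Memory} {T₁ T₂ : ℕ} {Q : Memory → Prop}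
    (hx : M.reg x ≠ 0) (h : Runs p M T₁ (fun M' => Runs (Prog.loop x p) M' T₂ Q)) :
    Runs (Prog.loop x p) M (1 + T₁ + T₂) Q := by
  obtain ⟨t, M', h₁, h₂, t', M'', h₃, h₄, h₅⟩ := h
  exact ⟨1 + t + t', M'', Exec.loop_step hx h₁ h₃, by omega, h₅⟩

/-- A loop with an invariant and a measure that decreases in each iteration. -/
theorem Runs.loop {x : ℕ} {p : Prog} (I : Memory → Prop) (μ : Memory → ℕ) (c : ℕ)
    (hstep : ∀ M, I M → M.reg x ≠ 0 → Runs p M c (fun M' => I M' ∧ μ M' < μ M))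
    {b : ℕ} : ∀ {M : Memory}, I M → μ M ≤ b →
      Runs (Prog.loop x p) M (b * (c + 1) + 1) (fun M' => I M' ∧ M'.reg x = 0) := by
  induction b with
  | zero =>
    intro M hI hb
    by_cases hx : M.reg x = 0
    · exact (Runs.loop_done hx (Q := fun M' => I M' ∧ M'.reg x = 0) ⟨hI, hx⟩).mono
        (by omega) (fun _ h => h)
    · obtain ⟨_, _, _, _, _, h⟩ := hstep M hI hx
      omega
  | succ b ih =>
    intro M hI hb
    by_cases hx : M.reg x = 0
    · exact (Runs.loop_done hx (Q := fun M' => I M' ∧ M'.reg x = 0) ⟨hI, hx⟩).mono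
        (by omega) (fun _ h => h)
    · refine (Runs.loop_step hx ((hstep M hI hx).mono le_rfl
        (fun M' h => ih h.1 (by omega)))).mono ?_ (fun _ h => h)
      ring_nf
      omega

/-- The weakest precondition of a program without loops. -/
def wp : Prog → Memory → (Memory → Prop) → Prop
  | Prog.skip, M, Q => Q M
  | Prog.const x c, M, Q => Q (M.setReg x c)
  | Prog.copy x y, M, Q => Q (M.setReg x (M.reg y))
  | Prog.succ x y, M, Q => Q (M.setReg x (M.reg y + 1))
  | Prog.sub x y z, M, Q => Q (M.setReg x (M.reg y - M.reg z))
  | Prog.load x k y, M, Q => Q (M.setReg x (M.arr k (M.reg y)))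
  | Prog.store k x y, M, Q => Q (M.setCell k (M.reg x) (M.reg y))
  | Prog.seq p q, M, Q => wp p M (fun M' => wp q M' Q)
  | Prog.ite x p q, M, Q => (M.reg x ≠ 0 → wp p M Q) ∧ (M.reg x = 0 → wp q M Q)
  | Prog.loop _ _, _, _ => False

/-- An upper bound for the running time of a program without loops. -/
def cost : Prog → ℕ
  | Prog.seq p q => cost p + cost q
  | Prog.ite _ p q => 1 + max (cost p) (cost q)
  | _ => 1

/-- Reduces loop-free code to symbolic execution by `simp`; a program containing a loop on a branch
that is taken has precondition `False`. -/
theorem runs_of_wp {p : Prog} : ∀ {M : Memory} {Q : Memory → Prop},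
    wp p M Q → Runs p M (cost p) Q := by
  induction p with
  | skip => exact fun h => ⟨1, _, Exec.skip _, le_rfl, h⟩
  | const x c => exact fun h => ⟨1, _, Exec.const x c _, le_rfl, h⟩
  | copy x y => exact fun h => ⟨1, _, Exec.copy x y _, le_rfl, h⟩
  | succ x y => exact fun h => ⟨1, _, Exec.succ x y _, le_rfl, h⟩
  | sub x y z => exact fun h => ⟨1, _, Exec.sub x y z _, le_rfl, h⟩
  | load x k y => exact fun h => ⟨1, _, Exec.load x k y _, le_rfl, h⟩
  | store k x y => exact fun h => ⟨1, _, Exec.store k x y _, le_rfl, h⟩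
  | seq p q ihp ihq => exact fun h => Runs.seq ((ihp h).mono le_rfl (fun _ h' => ihq h'))
  | ite x p q ihp ihq =>
    exact fun h => Runs.ite (fun hx => (ihp (h.1 hx)).mono (le_max_left _ _) (fun _ h => h))
      (fun hx => (ihq (h.2 hx)).mono (le_max_right _ _) (fun _ h => h))
  | loop x p _ => exact fun h => h.elim

@[simp] theorem Memory.reg_setReg (M : Memory) (x v y : ℕ) :
    (M.setReg x v).reg y = if y = x then v else M.reg y := by
  simp [Memory.setReg, Function.update_apply]

@[simp] theorem Memory.arr_setReg (M : Memory) (x v : ℕ) : (M.setReg x v).arr = M.arr := rfl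

@[simp] theorem Memory.reg_setCell (M : Memory) (k i v : ℕ) : (M.setCell k i v).reg = M.reg := rfl

@[simp] theorem Memory.arr_setCell (M : Memory) (k i v l : ℕ) :
    (M.setCell k i v).arr l = if l = k then Function.update (M.arr k) i v else M.arr l := by
  by_cases h : l = k
  · subst h; simp [Memory.setCell]
  · simp [Memory.setCell, h]

/-- `for i = reg N - 1, …, 0 do p`, where register `0` contains `1`. -/
def Prog.forDown (i N : ℕ) (p : Prog) : Prog :=
  Prog.seq (Prog.copy i N) (Prog.loop i (Prog.seq (Prog.sub i i 0) p))

/-- `I j` says that the indices from `j` on have been treated. The counter is decremented before the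
body, so the body sees `j`, may assume `I (j + 1)` and has to restore the counter to `j`. -/
theorem Runs.forDown {i N : ℕ} {p : Prog} {M : Memory} (I : ℕ → Memory → Prop) (c : ℕ)
    (hindep : ∀ j M' v, I j M' → I j (M'.setReg i v)) (hone : ∀ j M', I j M' → M'.reg 0 = 1)
    (hstart : I (M.reg N) M)
    (hstep : ∀ j M', M'.reg i = j → j < M.reg N → I (j + 1) M' →
      Runs p M' c (fun M'' => I j M'' ∧ M''.reg i = j)) :
    Runs (Prog.forDown i N p) M (M.reg N * (c + 2) + 2) (I 0) := by
  have key : ∀ M₁ : Memory, M₁.reg i ≤ M.reg N ∧ I (M₁.reg i) M₁ → M₁.reg i ≤ M.reg N →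
      Runs (Prog.loop i (Prog.seq (Prog.sub i i 0) p)) M₁ (M.reg N * (c + 1 + 1) + 1)
        (fun M' => (M'.reg i ≤ M.reg N ∧ I (M'.reg i) M') ∧ M'.reg i = 0) := by
    intro M₁ h₁ h₂
    refine Runs.loop (x := i) (fun M' => M'.reg i ≤ M.reg N ∧ I (M'.reg i) M')
      (fun M' => M'.reg i) (c + 1) ?_ h₁ h₂
    rintro M' ⟨hle, hI⟩ hx
    rw [add_comm]
    apply Runs.seq' (R := fun M'' => M'' = M'.setReg i (M'.reg i - 1))
      (runs_of_wp (p := Prog.sub i i 0) (by simp [wp, hone _ _ hI]))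
    rintro M'' rfl
    refine (hstep (M'.reg i - 1) _ (by simp) (by omega) ?_).mono le_rfl ?_
    · have h1 : M'.reg i - 1 + 1 = M'.reg i := by omega
      rw [h1]
      exact hindep _ _ _ hI
    · rintro M₂ ⟨h1, h2⟩
      rw [h2]
      exact ⟨⟨by omega, h1⟩, by omega⟩
  have := Runs.seq' (p := Prog.copy i N) (M := M) (R := fun M' => M' = M.setReg i (M.reg N))
    (runs_of_wp (p := Prog.copy i N) (by simp [wp]))
    (q := Prog.loop i (Prog.seq (Prog.sub i i 0) p)) (T₂ := M.reg N * (c + 2) + 1)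
    (Q := I 0) (by
      rintro _ rfl
      refine (key _ ⟨by simp, by simpa using hindep _ _ _ hstart⟩ (by simp)).mono
        (by ring_nf; omega) ?_
      rintro M' ⟨⟨_, h⟩, h0⟩
      rwa [h0] at h)
  refine this.mono ?_ (fun _ h => h)
  simp only [cost]
  omega

end RAM

/-! ### Dual ascent for minimum arborescences. -/

namespace SmartVoting

/-- A directed graph with vertices `0, …, n`, where `n` is the root, and edges `0, …, E - 1`.
The weight of the edge `e` is `cap (hd e) - sl e`. -/
structure EdgeData where
  n : ℕ
  E : ℕ
  tl : ℕ → ℕ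
  hd : ℕ → ℕ
  sl : ℕ → ℕ
  cap : ℕ → ℕ

namespace EdgeData

/-- The edges have heads among `0, …, n - 1`, and each such vertex is the head of an edge that
leaves the root. -/
structure WF (G : EdgeData) : Prop where
  hd_lt : ∀ e < G.E, G.hd e < G.n
  tl_le : ∀ e < G.E, G.tl e ≤ G.n
  sl_le : ∀ e < G.E, G.sl e ≤ G.cap (G.hd e)
  root_edge : ∀ v < G.n, ∃ e < G.E, G.hd e = v ∧ G.tl e = G.n

/-- The edge `e` enters the set `A`. -/
def Enters (G : EdgeData) (e : ℕ) (A : Finset ℕ) : Prop := G.hd e ∈ A ∧ G.tl e ∉ A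

instance (G : EdgeData) (e : ℕ) (A : Finset ℕ) : Decidable (G.Enters e A) :=
  inferInstanceAs (Decidable (_ ∧ _))

/-- The total dual value of the sets entered by `e`. -/
def dual (G : EdgeData) (S : ℕ → Finset ℕ) (y : ℕ → ℕ) (T e : ℕ) : ℕ :=
  ∑ t ∈ Finset.range T, if G.Enters e (S t) then y t else 0

/-- There is a path from `u` to `v` consisting of the edges `c 0, …, c (T - 1)`. -/
def Reach (G : EdgeData) (c : ℕ → ℕ) (T : ℕ) : ℕ → ℕ → Prop :=
  Relation.ReflTransGen (fun a b => ∃ t < T, G.tl (c t) = a ∧ G.hd (c t) = b)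

theorem Reach.mono {G : EdgeData} {c c' : ℕ → ℕ} {T T' : ℕ} (hT : T ≤ T')
    (hc : ∀ t < T, c' t = c t) {u v : ℕ} (h : G.Reach c T u v) : G.Reach c' T' u v := by
  refine Relation.ReflTransGen.mono ?_ u v h
  rintro a b ⟨t, ht, h1, h2⟩
  exact ⟨t, by omega, by rw [hc t ht, h1], by rw [hc t ht, h2]⟩

/-- The history of the dual ascent: edge `c t` was chosen at time `t`, when the dual variable of
the set `S t` was raised to `y t`. -/
structure History (G : EdgeData) (rem : ℕ → ℕ) (T : ℕ) (c : ℕ → ℕ) (S : ℕ → Finset ℕ)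
    (y : ℕ → ℕ) : Prop where
  edge_lt : ∀ t < T, c t < G.E
  sub : ∀ t < T, ∀ v ∈ S t, v < G.n
  nonempty : ∀ t < T, (S t).Nonempty
  rem_add : ∀ v < G.n, rem v + (∑ t ∈ Finset.range T, if v ∈ S t then y t else 0) = G.cap v
  feasible : ∀ e < G.E, G.dual S y T e + G.sl e ≤ G.cap (G.hd e)
  tight : ∀ t < T, G.dual S y T (c t) + G.sl (c t) = G.cap (G.hd (c t))
  not_enters : ∀ t < T, ∀ t' < t, ¬ G.Enters (c t') (S t)
  cross : ∀ t < T, ∀ R : ℕ → Prop, ∀ u ∈ S t, ∀ v ∈ S t, R u → ¬ R v →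
    ∃ t' < t, R (G.tl (c t')) ∧ ¬ R (G.hd (c t'))

/-- The labels of the vertices: `0` for vertices that were not visited, `1` for vertices that are
reachable from the root, and `2, …, K` for the components of the current path. -/
structure Labelled (G : EdgeData) (lab : ℕ → ℕ) (K T : ℕ) (c : ℕ → ℕ) (S : ℕ → Finset ℕ) :
    Prop where
  one_le : 1 ≤ K
  root : lab G.n = 1
  le_top : ∀ v ≤ G.n, lab v ≤ K
  top : 2 ≤ K → ∃ v < G.n, lab v = K
  edge : ∀ t < T, 1 ≤ lab (G.hd (c t)) ∧
    (lab (G.tl (c t)) = lab (G.hd (c t)) ∨ lab (G.tl (c t)) = lab (G.hd (c t)) + 1)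
  const : ∀ t < T, ∀ u ∈ S t, 1 ≤ lab u ∧ ∀ v ∈ S t, lab u = lab v
  reach : ∀ u ≤ G.n, ∀ v ≤ G.n, 2 ≤ lab v → lab v ≤ lab u → G.Reach c T u v
  reach_root : ∀ v ≤ G.n, lab v = 1 → G.Reach c T G.n v

/-- The vertices with label `K`. -/
def comp (G : EdgeData) (lab : ℕ → ℕ) (K : ℕ) : Finset ℕ :=
  (Finset.range G.n).filter (fun v => lab v = K)

variable {G : EdgeData} {lab rem c y : ℕ → ℕ} {K T : ℕ} {S : ℕ → Finset ℕ}

theorem mem_comp {v : ℕ} : v ∈ G.comp lab K ↔ v < G.n ∧ lab v = K := by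
  simp [comp]

/-- The root has label `1 < K`, so labels alone decide membership, even for a tail that is the root.
-/
theorem Labelled.enters_comp (hL : G.Labelled lab K T c S) (hG : G.WF) (hK : 2 ≤ K) {e : ℕ}
    (he : e < G.E) : G.Enters e (G.comp lab K) ↔ lab (G.hd e) = K ∧ lab (G.tl e) ≠ K := by
  have h1 := hG.hd_lt e he
  have h2 := hG.tl_le e he
  have h3 := hL.root
  simp only [Enters, mem_comp, h1, true_and, not_and]
  refine and_congr_right fun _ => ⟨fun h h' => ?_, fun h _ => h⟩
  rcases h2.lt_or_eq with h2 | h2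
  · exact h h2 h'
  · rw [h2] at h'; omega

/-- A recorded edge stays within a label or descends by one, and no label exceeds `K`. -/
theorem Labelled.not_enters_comp (hL : G.Labelled lab K T c S) (hG : G.WF)
    (hH : G.History rem T c S y) (hK : 2 ≤ K) {t : ℕ} (ht : t < T) :
    ¬ G.Enters (c t) (G.comp lab K) := by
  rw [hL.enters_comp hG hK (hH.edge_lt t ht)]
  rintro ⟨h1, h2⟩
  have h3 := (hL.edge t ht).2
  have h4 := hL.le_top _ (hG.tl_le _ (hH.edge_lt t ht))
  omega

/-- The dual value of an edge that enters the top component. -/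
theorem Labelled.dual_eq (hL : G.Labelled lab K T c S) (hG : G.WF)
    (hH : G.History rem T c S y) (hK : 2 ≤ K) {e : ℕ} (he : e < G.E)
    (hent : G.Enters e (G.comp lab K)) :
    rem (G.hd e) + G.dual S y T e = G.cap (G.hd e) := by
  rw [← hH.rem_add _ (hG.hd_lt e he), dual]
  congr 1
  refine Finset.sum_congr rfl fun t ht => ?_
  rw [Finset.mem_range] at ht
  rw [hL.enters_comp hG hK he] at hent
  -- Each earlier set carries a single label, and the tail of `e` is labelled differently from its
  -- head.
  have : G.Enters e (S t) ↔ G.hd e ∈ S t := by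
    refine ⟨fun h => h.1, fun h => ⟨h, fun h' => hent.2 ?_⟩⟩
    rw [← hent.1]
    exact (hL.const t ht _ h').2 _ h
  simp only [this]

/-- The root edge into any top vertex enters the component, so the search for a cheapest entering
edge never fails. -/
theorem Labelled.exists_enters (hL : G.Labelled lab K T c S) (hG : G.WF) (hK : 2 ≤ K) :
    ∃ e < G.E, lab (G.hd e) = K ∧ lab (G.tl e) ≠ K := by
  obtain ⟨v, hv, hvK⟩ := hL.top hK
  obtain ⟨e, he, h1, h2⟩ := hG.root_edge v hv
  refine ⟨e, he, by rw [h1, hvK], ?_⟩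
  rw [h2, hL.root]; omega

theorem dual_update (G : EdgeData) (S : ℕ → Finset ℕ) (y : ℕ → ℕ) (T e : ℕ) (A : Finset ℕ)
    (δ : ℕ) : G.dual (Function.update S T A) (Function.update y T δ) (T + 1) e =
      G.dual S y T e + if G.Enters e A then δ else 0 := by
  rw [dual, Finset.sum_range_succ, dual]
  congr 1
  · refine Finset.sum_congr rfl fun t ht => ?_
    rw [Finset.mem_range] at ht
    simp [Function.update_of_ne ht.ne]
  · simp

theorem Reach.cross {R : ℕ → Prop} {u v : ℕ}
    (h : G.Reach c T u v) (hu : R u) (hv : ¬ R v) :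
    ∃ t < T, R (G.tl (c t)) ∧ ¬ R (G.hd (c t)) := by
  induction h with
  | refl => exact absurd hu hv
  | @tail b d _ h2 ih =>
    by_cases hb : R b
    · obtain ⟨t, ht, rfl, rfl⟩ := h2
      exact ⟨t, ht, hb, hv⟩
    · exact ih hb

/-- Raising the dual variable of the top component. -/
theorem History.push (hG : G.WF) (hH : G.History rem T c S y) (hL : G.Labelled lab K T c S)
    (hK : 2 ≤ K) {e : ℕ} (he : e < G.E) (h1 : lab (G.hd e) = K) (h2 : lab (G.tl e) ≠ K)
    (hmin : ∀ e' < G.E, lab (G.hd e') = K → lab (G.tl e') ≠ K →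
      rem (G.hd e) - G.sl e ≤ rem (G.hd e') - G.sl e') :
    G.History (fun v => if v < G.n ∧ lab v = K then rem v - (rem (G.hd e) - G.sl e) else rem v)
      (T + 1) (Function.update c T e) (Function.update S T (G.comp lab K))
      (Function.update y T (rem (G.hd e) - G.sl e)) := by
  have hent : G.Enters e (G.comp lab K) := (hL.enters_comp hG hK he).2 ⟨h1, h2⟩
  have hcap := hL.dual_eq hG hH hK he hent
  have hfe := hH.feasible e he
  set δ := rem (G.hd e) - G.sl e with hδ
  have hlt : ∀ t < T, Function.update c T e t = c t := fun t ht => Function.update_of_ne ht.ne _ _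
  have hltS : ∀ t < T, Function.update S T (G.comp lab K) t = S t :=
    fun t ht => Function.update_of_ne ht.ne _ _
  have hcases : ∀ {t}, t < T + 1 → t < T ∨ t = T := fun h => by omega
  refine ⟨?_, ?_, ?_, ?_, ?_, ?_, ?_, ?_⟩
  · intro t ht
    rcases hcases ht with h | rfl
    · rw [hlt t h]; exact hH.edge_lt t h
    · simpa using he
  · intro t ht
    rcases hcases ht with h | rfl
    · rw [hltS t h]; exact hH.sub t h
    · simp only [Function.update_self, mem_comp]; exact fun v hv => hv.1
  · intro t ht
    rcases hcases ht with h | rfl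
    · rw [hltS t h]; exact hH.nonempty t h
    · simp only [Function.update_self]
      exact ⟨_, hent.1⟩
  · intro v hv
    have hr := hH.rem_add v hv
    rw [Finset.sum_range_succ]
    have hs : (∑ t ∈ Finset.range T, if v ∈ Function.update S T (G.comp lab K) t then
        Function.update y T δ t else 0) = ∑ t ∈ Finset.range T, if v ∈ S t then y t else 0 := by
      refine Finset.sum_congr rfl fun t ht => ?_
      rw [Finset.mem_range] at ht
      rw [hltS t ht, Function.update_of_ne ht.ne]
    rw [hs]
    simp only [Function.update_self, mem_comp]
    by_cases hvK : v < G.n ∧ lab v = K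
    -- The subtraction from `rem v` must not truncate: the root edge into `v` enters the component,
    -- so the increment is at most `rem v`.
    · obtain ⟨e', he', h1', h2'⟩ := hG.root_edge v hv
      have := hmin e' he' (by rw [h1']; exact hvK.2) (by rw [h2', hL.root]; omega)
      rw [h1'] at this
      simp only [hvK, and_self, if_true]
      omega
    · simp only [hvK, if_false]; omega
  · intro e' he'
    rw [dual_update]
    have := hH.feasible e' he'
    split_ifs with hent'
    · have h3 := hL.dual_eq hG hH hK he' hent'
      have h4 := (hL.enters_comp hG hK he').1 hent'
      have := hmin e' he' h4.1 h4.2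
      omega
    · omega
  · intro t ht
    rw [dual_update]
    rcases hcases ht with h | rfl
    · rw [hlt t h, if_neg (hL.not_enters_comp hG hH hK h)]
      exact hH.tight t h
    · simp only [Function.update_self, hent, if_true]
      omega
  · intro t ht t' ht'
    rcases hcases ht with h | rfl
    · rw [hltS t h, hlt t' (ht'.trans h)]; exact hH.not_enters t h t' ht'
    · rw [hlt t' ht', Function.update_self]; exact hL.not_enters_comp hG hH hK ht'
  · intro t ht R u hu v hv hRu hRv
    rcases hcases ht with h | rfl
    · rw [hltS t h] at hu hv
      obtain ⟨t', ht', h'⟩ := hH.cross t h R u hu v hv hRu hRv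
      exact ⟨t', ht', by rwa [hlt t' (ht'.trans h)]⟩
    · rw [Function.update_self, mem_comp] at hu hv
      -- Vertices of the top component reach each other by edges recorded before time `T`.
      obtain ⟨t', ht', h'⟩ := Reach.cross (R := R)
        (hL.reach u hu.1.le v hv.1.le (by omega) (by omega)) hRu hRv
      exact ⟨t', ht', by rwa [hlt t' ht']⟩

/-- The path is extended by a vertex that was not visited before. -/
theorem Labelled.extend (hG : G.WF) (hH : G.History rem T c S y) (hL : G.Labelled lab K T c S)
    (hK : 2 ≤ K) {e : ℕ} (he : e < G.E) (h1 : lab (G.hd e) = K) (h2 : lab (G.tl e) = 0) :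
    G.Labelled (Function.update lab (G.tl e) (K + 1)) (K + 1) (T + 1) (Function.update c T e)
      (Function.update S T (G.comp lab K)) := by
  have hlt : ∀ t < T, Function.update c T e t = c t := fun t ht => Function.update_of_ne ht.ne _ _
  have hltS : ∀ t < T, Function.update S T (G.comp lab K) t = S t :=
    fun t ht => Function.update_of_ne ht.ne _ _
  have hcases : ∀ {t}, t < T + 1 → t < T ∨ t = T := fun h => by omega
  have hmono : ∀ {u v}, G.Reach c T u v → G.Reach (Function.update c T e) (T + 1) u v :=
    fun h => h.mono (by omega) hlt
  have hup : ∀ v, 1 ≤ lab v → Function.update lab (G.tl e) (K + 1) v = lab v := by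
    intro v hv
    refine Function.update_of_ne ?_ _ _
    rintro rfl; omega
  have hroot := hL.root
  have htl : G.tl e < G.n := by
    refine lt_of_le_of_ne (hG.tl_le e he) ?_
    intro h; rw [h] at h2; omega
  have hnew : G.Reach (Function.update c T e) (T + 1) (G.tl e) (G.hd e) :=
    Relation.ReflTransGen.single ⟨T, by omega, by simp, by simp⟩
  -- The head of `e` has the top label and therefore reaches every label from `2` on; the tail
  -- inherits this through `e`.
  have htop : ∀ v ≤ G.n, 2 ≤ lab v →
      G.Reach (Function.update c T e) (T + 1) (G.tl e) v := fun v hv hv2 =>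
    hnew.trans (hmono (hL.reach _ (hG.hd_lt e he).le v hv hv2 (by rw [h1]; exact hL.le_top v hv)))
  refine ⟨by omega, by rw [hup _ (by omega), hroot], ?_, ?_, ?_, ?_, ?_, ?_⟩
  · intro v hv
    have := hL.le_top v hv
    rw [Function.update_apply]; split_ifs <;> omega
  · exact fun _ => ⟨_, htl, by simp⟩
  · intro t ht
    rcases hcases ht with h | rfl
    · rw [hlt t h]
      have := hL.edge t h
      rw [hup _ this.1, hup _ (by omega)]
      exact this
    · simp only [Function.update_self]
      rw [hup _ (by omega)]
      omega
  · intro t ht u hu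
    rcases hcases ht with h | rfl
    · rw [hltS t h] at hu ⊢
      have := hL.const t h u hu
      refine ⟨by rw [hup _ this.1]; exact this.1, fun v hv => ?_⟩
      rw [hup _ this.1, hup _ (hL.const t h v hv).1]
      exact this.2 v hv
    · simp only [Function.update_self, mem_comp] at hu ⊢
      rw [hup _ (by omega)]
      refine ⟨by omega, fun v hv => ?_⟩
      rw [hup _ (by omega)]
      omega
  · intro u hu v hv hv2 hvu
    by_cases hue : u = G.tl e
    · subst hue
      by_cases hve : v = G.tl e
      · subst hve; exact Relation.ReflTransGen.refl
      · rw [Function.update_of_ne hve] at hv2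
        exact htop v hv hv2
    · rw [Function.update_of_ne hue] at hvu
      have := hL.le_top u hu
      by_cases hve : v = G.tl e
      · subst hve; rw [Function.update_self] at hvu; omega
      · rw [Function.update_of_ne hve] at hvu hv2
        exact hmono (hL.reach u hu v hv hv2 hvu)
  · intro v hv hv1
    by_cases hve : v = G.tl e
    · subst hve; rw [Function.update_self] at hv1; omega
    · rw [Function.update_of_ne hve] at hv1
      exact hmono (hL.reach_root v hv hv1)

/-- The components of the path from the label `j` on are merged. -/
theorem Labelled.merge (hG : G.WF) (hH : G.History rem T c S y) (hL : G.Labelled lab K T c S)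
    (hK : 2 ≤ K) {e : ℕ} (he : e < G.E) (h1 : lab (G.hd e) = K) (h2 : lab (G.tl e) ≠ 0)
    {lab' : ℕ → ℕ} (hlab' : ∀ v ≤ G.n, lab' v = min (lab v) (lab (G.tl e))) :
    G.Labelled lab' (lab (G.tl e)) (T + 1)
      (Function.update c T e) (Function.update S T (G.comp lab K)) := by
  have hlt : ∀ t < T, Function.update c T e t = c t := fun t ht => Function.update_of_ne ht.ne _ _
  have hltS : ∀ t < T, Function.update S T (G.comp lab K) t = S t :=
    fun t ht => Function.update_of_ne ht.ne _ _
  have hcases : ∀ {t}, t < T + 1 → t < T ∨ t = T := fun h => by omega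
  have hmono : ∀ {u v}, G.Reach c T u v → G.Reach (Function.update c T e) (T + 1) u v :=
    fun h => h.mono (by omega) hlt
  have hroot := hL.root
  have htl := hG.tl_le e he
  have hnew : G.Reach (Function.update c T e) (T + 1) (G.tl e) (G.hd e) :=
    Relation.ReflTransGen.single ⟨T, by omega, by simp, by simp⟩
  have htop : ∀ v ≤ G.n, 2 ≤ lab v →
      G.Reach (Function.update c T e) (T + 1) (G.tl e) v := fun v hv hv2 =>
    hnew.trans (hmono (hL.reach _ (hG.hd_lt e he).le v hv hv2 (by rw [h1]; exact hL.le_top v hv)))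
  refine ⟨by omega, by rw [hlab' _ le_rfl, hroot]; omega,
    fun v hv => (hlab' v hv).trans_le (min_le_right _ _), ?_, ?_, ?_, ?_, ?_⟩
  · intro hj
    refine ⟨G.tl e, lt_of_le_of_ne htl ?_, by rw [hlab' _ htl, min_self]⟩
    intro h; rw [h] at hj; omega
  · intro t ht
    rcases hcases ht with h | rfl
    · rw [hlt t h, hlab' _ (hG.tl_le _ (hH.edge_lt t h)),
        hlab' _ (hG.hd_lt _ (hH.edge_lt t h)).le]
      have := hL.edge t h
      omega
    · simp only [Function.update_self]
      rw [hlab' _ htl, hlab' _ (hG.hd_lt e he).le]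
      have := hL.le_top _ htl
      omega
  · intro t ht u hu
    rcases hcases ht with h | rfl
    · rw [hltS t h] at hu ⊢
      have := hL.const t h u hu
      rw [hlab' u (hH.sub t h u hu).le]
      refine ⟨by omega, fun v hv => ?_⟩
      rw [hlab' v (hH.sub t h v hv).le, this.2 v hv]
    · simp only [Function.update_self, mem_comp] at hu ⊢
      rw [hlab' u hu.1.le]
      refine ⟨by omega, fun v hv => ?_⟩
      rw [hlab' v hv.1.le, hu.2, hv.2]
  · intro u hu v hv hv2 hvu
    rw [hlab' v hv] at hv2 hvu
    rw [hlab' u hu] at hvu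
    -- Otherwise `v` lies higher on the old path than `u`, and both are merged: go down from `u` to
    -- the tail of `e`, across `e` to the top, and down to `v`.
    by_cases hlab : lab v ≤ lab u
    · exact hmono (hL.reach u hu v hv (by omega) hlab)
    · exact (hmono (hL.reach u hu _ htl (by omega) (by omega))).trans (htop v hv (by omega))
  · intro v hv hv1
    rw [hlab' v hv] at hv1
    by_cases hlab : lab v = 1
    · exact hmono (hL.reach_root v hv hlab)
    · exact (hmono (hL.reach_root _ htl (by omega))).trans (htop v hv (by omega))

/-- A new path is started at a vertex that was not visited before. -/
theorem Labelled.start (hL : G.Labelled lab 1 T c S) {x : ℕ} (hx : x < G.n) (hx0 : lab x = 0) :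
    G.Labelled (Function.update lab x 2) 2 T c S := by
  have hup : ∀ v, 1 ≤ lab v → Function.update lab x 2 v = lab v := by
    intro v hv
    refine Function.update_of_ne ?_ _ _
    rintro rfl; omega
  have hroot := hL.root
  refine ⟨by omega, by rw [hup _ (by omega), hroot], ?_, fun _ => ⟨x, hx, by simp⟩, ?_, ?_, ?_, ?_⟩
  · intro v hv
    have := hL.le_top v hv
    rw [Function.update_apply]; split_ifs <;> omega
  · intro t h
    have := hL.edge t h
    rw [hup _ this.1, hup _ (by omega)]
    exact this
  · intro t h u hu
    have := hL.const t h u hu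
    refine ⟨by rw [hup _ this.1]; exact this.1, fun v hv => ?_⟩
    rw [hup _ this.1, hup _ (hL.const t h v hv).1]
    exact this.2 v hv
  · intro u hu v hv hv2 hvu
    have h3 := hL.le_top u hu
    have h4 := hL.le_top v hv
    rw [Function.update_apply] at hv2 hvu
    rw [Function.update_apply] at hvu
    split_ifs at hv2 hvu with h5 h6
    · rw [h5, h6]; exact Relation.ReflTransGen.refl
    all_goals omega
  · intro v hv hv1
    rw [Function.update_apply] at hv1
    split_ifs at hv1
    · omega
    exact hL.reach_root v hv hv1

theorem history_zero (hG : G.WF) (c : ℕ → ℕ) (h : ∀ v < G.n, rem v = G.cap v) :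
    G.History rem 0 c (fun _ => ∅) (fun _ => 0) :=
  ⟨by simp, by simp, by simp, by simpa using h, fun e he => by simpa [dual] using hG.sl_le e he,
    by simp, by simp, by simp⟩

theorem labelled_zero (c : ℕ → ℕ) (h : lab G.n = 1) (h0 : ∀ v < G.n, lab v = 0) :
    G.Labelled lab 1 0 c (fun _ => ∅) := by
  have key : ∀ v ≤ G.n, lab v ≤ 1 ∧ (lab v = 1 → v = G.n) := by
    intro v hv
    rcases hv.lt_or_eq with h' | rfl
    · simp [h0 v h']
    · simp [h]
  refine ⟨le_rfl, h, fun v hv => (key v hv).1, by omega, by simp, by simp, ?_, ?_⟩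
  · intro u hu v hv hv2
    have := (key v hv).1
    omega
  · intro v hv hv1
    rw [(key v hv).2 hv1]
    exact Relation.ReflTransGen.refl

/-! ### Growing the tree and weak duality. -/

/-- The state of the second phase: the vertices `v` with `ρ v ≠ 0` have been reached, in the order
given by `ρ`, and `f v` is the edge by which `v` was reached. -/
structure Tree (G : EdgeData) (T : ℕ) (c : ℕ → ℕ) (S : ℕ → Finset ℕ) (vote₀ : ℕ → ℕ)
    (q : ℕ) (ρ vote f : ℕ → ℕ) : Prop where
  root : ρ G.n ≠ 0
  le : ∀ v < G.n, ρ v ≤ q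
  inj : ∀ u < G.n, ∀ v < G.n, ρ u ≠ 0 → ρ u = ρ v → u = v
  card : ((Finset.range G.n).filter (fun v => ρ v ≠ 0)).card = q
  edge : ∀ v < G.n, ρ v ≠ 0 → (∃ t < T, f v = c t) ∧ G.hd (f v) = v ∧
    (G.tl (f v) = G.n ∧ vote v = vote₀ v ∨
      G.tl (f v) < G.n ∧ ρ (G.tl (f v)) ≠ 0 ∧ ρ (G.tl (f v)) < ρ v ∧ vote v = vote (G.tl (f v)))
  vote_eq : ∀ v < G.n, ρ v = 0 → vote v = vote₀ v
  unique : ∀ t < T, ∀ u ∈ S t, ∀ v ∈ S t, ρ u ≠ 0 → ρ v ≠ 0 → G.tl (f u) ∉ S t →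
    G.tl (f v) ∉ S t → u = v

variable {vote₀ ρ vote f : ℕ → ℕ} {q : ℕ}

/-- The recorded path from the root to an unreached vertex has to leave the reached set somewhere.
-/
theorem Tree.exists_edge (hT : G.Tree T c S vote₀ q ρ vote f) (hq : q < G.n)
    (hreach : ∀ v < G.n, G.Reach c T G.n v) :
    ∃ t < T, ρ (G.tl (c t)) ≠ 0 ∧ ρ (G.hd (c t)) = 0 := by
  have : ∃ v < G.n, ρ v = 0 := by
    by_contra! h
    have h1 : (Finset.range G.n).filter (fun v => ρ v ≠ 0) = Finset.range G.n :=
      Finset.filter_true_of_mem fun v hv => h v (Finset.mem_range.1 hv)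
    have h2 := hT.card
    rw [h1, Finset.card_range] at h2
    omega
  obtain ⟨v, hv, hv0⟩ := this
  obtain ⟨t, ht, h1, h2⟩ := Reach.cross (R := fun v => ρ v ≠ 0) (hreach v hv) hT.root
    (by simpa using hv0)
  exact ⟨t, ht, h1, by simpa using h2⟩

/-- The minimality of `t` is what preserves `unique`. A vertex reached from the root keeps its
stored vote, which is still its initial one; any other copies the vote of its tail. -/
theorem Tree.step (hG : G.WF) (hH : G.History rem T c S y)
    (hT : G.Tree T c S vote₀ q ρ vote f) {t : ℕ} (ht : t < T) (h1 : ρ (G.tl (c t)) ≠ 0)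
    (h2 : ρ (G.hd (c t)) = 0)
    (hmin : ∀ t' < t, ¬ (ρ (G.tl (c t')) ≠ 0 ∧ ρ (G.hd (c t')) = 0)) :
    G.Tree T c S vote₀ (q + 1) (Function.update ρ (G.hd (c t)) (q + 1))
      (if G.tl (c t) = G.n then vote else
        Function.update vote (G.hd (c t)) (vote (G.tl (c t))))
      (Function.update f (G.hd (c t)) (c t)) := by
  set x := G.hd (c t) with hx
  have hxn : x < G.n := hG.hd_lt _ (hH.edge_lt t ht)
  have hne : ∀ v, ρ v ≠ 0 → v ≠ x := by rintro v hv rfl; exact hv h2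
  have hρ : ∀ v, ρ v ≠ 0 → Function.update ρ x (q + 1) v = ρ v :=
    fun v hv => Function.update_of_ne (hne v hv) _ _
  have hvote : ∀ v, v ≠ x → (if G.tl (c t) = G.n then vote else
        Function.update vote x (vote (G.tl (c t)))) v = vote v := by
    intro v hv
    split_ifs
    · rfl
    · exact Function.update_of_ne hv _ _
  have hle := hT.le
  refine ⟨by rw [hρ _ hT.root]; exact hT.root, ?_, ?_, ?_, ?_, ?_, ?_⟩
  · intro v hv
    have := hle v hv
    rw [Function.update_apply]; split_ifs <;> omega
  · intro u hu v hv hu0 huv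
    have h3 := hle u hu
    have h4 := hle v hv
    simp only [Function.update_apply] at hu0 huv
    split_ifs at hu0 huv with h5 h6 h6
    · rw [h5, h6]
    · omega
    · omega
    · exact hT.inj u hu v hv hu0 huv
  · have : (Finset.range G.n).filter (fun v => Function.update ρ x (q + 1) v ≠ 0) =
        insert x ((Finset.range G.n).filter (fun v => ρ v ≠ 0)) := by
      ext v
      simp only [Finset.mem_filter, Finset.mem_range, Finset.mem_insert, Function.update_apply]
      by_cases hvx : v = x
      · simp [hvx, hxn]
      · simp [hvx]
    rw [this, Finset.card_insert_of_notMem (by simp [h2]), hT.card]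
  · intro v hv hv0
    by_cases hvx : v = x
    · subst hvx
      simp only [Function.update_self]
      refine ⟨⟨t, ht, rfl⟩, rfl, ?_⟩
      rcases (hG.tl_le _ (hH.edge_lt t ht)).lt_or_eq with h | h
      · right
        rw [hρ _ h1, if_neg h.ne]
        have := hle _ h
        refine ⟨h, h1, by omega, ?_⟩
        rw [Function.update_self, Function.update_of_ne (hne _ h1)]
      · left
        exact ⟨h, by rw [if_pos h]; exact hT.vote_eq _ hxn h2⟩
    · rw [Function.update_of_ne hvx] at hv0
      rw [Function.update_of_ne hvx, hvote v hvx, Function.update_of_ne hvx]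
      obtain ⟨h3, h4, h5⟩ := hT.edge v hv hv0
      refine ⟨h3, h4, h5.imp id ?_⟩
      rintro ⟨h6, h7, h8, h9⟩
      rw [hρ _ h7, hvote _ (hne _ h7)]
      exact ⟨h6, h7, h8, h9⟩
  · intro v hv hv0
    by_cases hvx : v = x
    · subst hvx; simp at hv0
    · rw [Function.update_of_ne hvx] at hv0
      rw [hvote v hvx]
      exact hT.vote_eq v hv hv0
  -- If the new edge enters `S s`, nothing in `S s` was reached. Otherwise `cross` gives a usable
  -- edge at a time `t' < s`, minimality gives `t ≤ t'`, and `not_enters` is violated at `t < s`.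
  · have key : ∀ s < T, x ∈ S s → G.tl (c t) ∉ S s → ∀ v ∈ S s, ρ v = 0 := by
      intro s hs hxs hts v hv
      by_contra hv0
      obtain ⟨t', ht', h3, h4⟩ := hH.cross s hs (fun v => ρ v ≠ 0) v hv x hxs hv0 (by simpa using h2)
      have h5 : t ≤ t' := by
        by_contra h
        exact hmin t' (by omega) ⟨h3, by simpa using h4⟩
      exact hH.not_enters s hs t (by omega) ⟨hxs, hts⟩
    intro s hs u hu v hv hu0 hv0 hfu hfv
    by_cases hux : u = x <;> by_cases hvx : v = x
    · rw [hux, hvx]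
    · rw [hux, Function.update_self] at hfu
      rw [Function.update_of_ne hvx] at hv0
      exact absurd (key s hs (hux ▸ hu) hfu v hv) hv0
    · rw [hvx, Function.update_self] at hfv
      rw [Function.update_of_ne hux] at hu0
      exact absurd (key s hs (hvx ▸ hv) hfv u hu) hu0
    · rw [Function.update_of_ne hux] at hu0 hfu
      rw [Function.update_of_ne hvx] at hv0 hfv
      exact hT.unique s hs u hu v hv hu0 hv0 hfu hfv

theorem tree_zero (vote : ℕ → ℕ) (f : ℕ → ℕ) (h : ρ G.n ≠ 0) (h0 : ∀ v < G.n, ρ v = 0)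
    (hH : G.History rem T c S y) : G.Tree T c S vote 0 ρ vote f := by
  refine ⟨h, fun v hv => (h0 v hv).le, fun u hu v _ hu0 => absurd (h0 u hu) hu0, ?_,
    fun v hv hv0 => absurd (h0 v hv) hv0, fun _ _ _ => rfl,
    fun t ht u hu v _ hu0 => absurd (h0 u (hH.sub t ht u hu)) hu0⟩
  simpa [Finset.filter_eq_empty_iff] using h0

theorem Tree.reached (hT : G.Tree T c S vote₀ G.n ρ vote f) : ∀ v < G.n, ρ v ≠ 0 := by
  have h := Finset.eq_of_subset_of_card_le
    (Finset.filter_subset (fun v => ρ v ≠ 0) (Finset.range G.n)) (by simp [hT.card])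
  intro v hv
  rw [← Finset.mem_range, ← h] at hv
  exact (Finset.mem_filter.1 hv).2

/-- Weak duality: the tree found in the second phase has minimum weight. -/
theorem Tree.weight_le (hH : G.History rem T c S y)
    (hT : G.Tree T c S vote₀ G.n ρ vote f) {g τ : ℕ → ℕ}
    (hg : ∀ v < G.n, g v < G.E ∧ G.hd (g v) = v ∧
      (G.tl (g v) = G.n ∨ G.tl (g v) < G.n ∧ τ (G.tl (g v)) < τ v)) :
    ∑ v ∈ Finset.range G.n, (G.cap v - G.sl (f v)) ≤
      ∑ v ∈ Finset.range G.n, (G.cap v - G.sl (g v)) := by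
  have hall := hT.reached
  calc ∑ v ∈ Finset.range G.n, (G.cap v - G.sl (f v))
      = ∑ v ∈ Finset.range G.n, G.dual S y T (f v) := by
        refine Finset.sum_congr rfl fun v hv => ?_
        obtain ⟨⟨t, ht, h1⟩, h2, _⟩ := hT.edge v (Finset.mem_range.1 hv) (hall v (Finset.mem_range.1 hv))
        have := hH.tight t ht
        rw [← h1, h2] at this
        omega
    _ = ∑ t ∈ Finset.range T, ∑ v ∈ Finset.range G.n,
          if G.Enters (f v) (S t) then y t else 0 := Finset.sum_comm
    _ ≤ ∑ t ∈ Finset.range T, y t := by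
        refine Finset.sum_le_sum fun t ht => ?_
        rw [Finset.mem_range] at ht
        rw [← Finset.sum_filter, Finset.sum_const, smul_eq_mul]
        refine (Nat.mul_le_mul_right _ (Finset.card_le_one.2 ?_)).trans (one_mul _).le
        intro u hu v hv
        rw [Finset.mem_filter, Finset.mem_range] at hu hv
        have h1 := (hT.edge u hu.1 (hall u hu.1)).2.1
        have h2 := (hT.edge v hv.1 (hall v hv.1)).2.1
        exact hT.unique t ht u (h1 ▸ hu.2.1) v (h2 ▸ hv.2.1) (hall u hu.1) (hall v hv.1)
          hu.2.2 hv.2.2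
    _ ≤ ∑ t ∈ Finset.range T, ∑ v ∈ Finset.range G.n,
          if G.Enters (g v) (S t) then y t else 0 := by
        refine Finset.sum_le_sum fun t ht => ?_
        rw [Finset.mem_range] at ht
        -- The `τ`-first vertex of `S t` has its tail outside `S t`, so the competitor `g` enters
        -- the set at least once.
        obtain ⟨v, hv, hmin⟩ := Finset.exists_min_image (S t) τ (hH.nonempty t ht)
        have hvn := hH.sub t ht v hv
        obtain ⟨_, h1, h2⟩ := hg v hvn
        have : G.Enters (g v) (S t) := by
          refine ⟨h1.symm ▸ hv, fun h => ?_⟩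
          have h3 := hH.sub t ht _ h
          have h4 := hmin _ h
          omega
        calc y t = if G.Enters (g v) (S t) then y t else 0 := by rw [if_pos this]
          _ ≤ _ := Finset.single_le_sum
            (f := fun v => if G.Enters (g v) (S t) then y t else 0)
            (fun _ _ => Nat.zero_le _) (Finset.mem_range.2 hvn)
    _ = ∑ v ∈ Finset.range G.n, G.dual S y T (g v) := Finset.sum_comm
    _ ≤ _ := by
        refine Finset.sum_le_sum fun v hv => ?_
        obtain ⟨h1, h2, _⟩ := hg v (Finset.mem_range.1 hv)
        have := hH.feasible _ h1
        rw [h2] at this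
        omega

end EdgeData

end SmartVoting

/-! ### Scans and updates of the memory. -/

namespace SmartVoting

open RAM

/-- The contents of the memory during the two phases of the algorithm. -/
structure Mem (G : EdgeData) (lab rem c vote ρ : ℕ → ℕ) (K T : ℕ) (M : Memory) : Prop where
  one : M.reg 0 = 1
  n : M.reg 1 = G.n
  E : M.reg 2 = G.E
  top : M.reg 3 = K
  time : M.reg 4 = T
  vote : M.arr 1 = vote
  tl : ∀ e < G.E, M.arr 2 e = G.tl e
  hd : ∀ e < G.E, M.arr 3 e = G.hd e
  sl : ∀ e < G.E, M.arr 4 e = G.sl e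
  rem : M.arr 5 = rem
  lab : M.arr 6 = lab
  c : M.arr 7 = c
  reached : M.arr 8 = ρ

variable {G : EdgeData} {lab rem c vote ρ : ℕ → ℕ} {K T : ℕ} {M : Memory}

/-- Registers `0` to `4` are the only ones that `Mem` constrains; all others are scratch space. -/
theorem Mem.setReg (h : Mem G lab rem c vote ρ K T M) {x : ℕ} (hx : 5 ≤ x) (v : ℕ) :
    Mem G lab rem c vote ρ K T (M.setReg x v) := by
  obtain ⟨h1, h2, h3, h4, h5, h6, h7, h8, h9, h10, h11, h12, h13⟩ := h
  constructor <;> simp_all <;> intro h <;> omega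

/-- Register `7` is set to `v + 1` for some vertex `v` that was not visited, or to `0`. -/
def findProg : Prog :=
  .seq (.const 7 0) (.forDown 5 1 (.seq (.load 6 6 5) (.ite 6 .skip (.succ 7 5))))

theorem findProg_runs (h : Mem G lab rem c vote ρ K T M) :
    Runs findProg M (10 * G.n + 3) (fun M' => Mem G lab rem c vote ρ K T M' ∧
      M'.reg 15 = M.reg 15 ∧
      (M'.reg 7 = 0 ∧ (∀ v < G.n, lab v ≠ 0) ∨
        ∃ v < G.n, M'.reg 7 = v + 1 ∧ lab v = 0)) := by
  refine (Runs.seq' (T₁ := 1) (R := fun M' => Mem G lab rem c vote ρ K T M' ∧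
    M'.reg 15 = M.reg 15 ∧ M'.reg 7 = 0) (runs_of_wp (by simp [wp, h.setReg])) ?_
    (T₂ := G.n * 5 + 2)).mono (by omega) (fun _ h => h)
  rintro M₁ ⟨h₁, h15, h7⟩
  have hn := h₁.n
  refine (Runs.forDown (fun i M' => Mem G lab rem c vote ρ K T M' ∧ M'.reg 15 = M.reg 15 ∧
      (M'.reg 7 = 0 ∧ (∀ v < G.n, i ≤ v → lab v ≠ 0) ∨
        ∃ v < G.n, M'.reg 7 = v + 1 ∧ lab v = 0)) 3 ?_ ?_ ?_ ?_).mono (by rw [hn]) ?_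
  · rintro j M' v ⟨h1, h2⟩
    exact ⟨h1.setReg (by omega) _, by simpa using h2⟩
  · exact fun j M' h => h.1.one
  · refine ⟨h₁, h15, .inl ⟨h7, fun v hv => ?_⟩⟩
    rw [h₁.n]; omega
  · rintro j M' hj hjn ⟨h1, h2, h3⟩
    rw [h₁.n] at hjn
    refine runs_of_wp ?_
    simp only [wp]
    have h1' := h1.setReg (x := 6) (by omega) (M'.arr 6 (M'.reg 5))
    refine ⟨fun hx => ⟨⟨h1', by simpa using h2, ?_⟩, by simpa using hj⟩,
      fun hx => ⟨⟨h1'.setReg (by omega) _, by simpa using h2, ?_⟩, by simpa using hj⟩⟩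
    · simp only [Memory.reg_setReg, hj, h1.lab, if_true] at hx
      rcases h3 with h3 | h3
      · left
        refine ⟨by simpa using h3.1, fun v hv hjv => ?_⟩
        rcases hjv.eq_or_lt with rfl | hjv
        · exact hx
        · exact h3.2 v hv hjv
      · right
        simpa using h3
    · simp only [Memory.reg_setReg, hj, h1.lab, if_true] at hx
      right
      exact ⟨j, hjn, by simp [hj], hx⟩
  · rintro M' ⟨h1, h2, h3⟩
    exact ⟨h1, h2, by simpa using h3⟩

/-- Register `11` is set to `e + 1` for an edge `e` of least reduced cost that enters the top
component, and register `12` is set to its reduced cost. -/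
def scanProg : Prog :=
  .seq (.const 11 0) (.forDown 5 2
    (.seq (.load 6 3 5) (.seq (.load 7 6 6) (.seq (.sub 8 3 7) (.ite 8 .skip
      (.seq (.load 9 2 5) (.seq (.load 10 6 9) (.seq (.sub 8 3 10) (.ite 8
        (.seq (.load 7 5 6) (.seq (.load 8 4 5) (.seq (.sub 7 7 8)
          (.seq (.ite 11 (.sub 8 12 7) (.const 8 1))
            (.ite 8 (.seq (.copy 12 7) (.succ 11 5)) .skip)))))
        .skip)))))))))

/-- The conditions are inequalities because truncated subtraction tests exactly these; they become
`= K` and `≠ K` once labels are known to be at most `K`. Register `15` is preserved because it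
controls the enclosing loop. -/
theorem scanProg_runs (h : Mem G lab rem c vote ρ K T M)
    (hex : ∃ e < G.E, K ≤ lab (G.hd e) ∧ lab (G.tl e) < K) :
    Runs scanProg M (20 * G.E + 3) (fun M' => Mem G lab rem c vote ρ K T M' ∧
      M'.reg 15 = M.reg 15 ∧ ∃ e < G.E, K ≤ lab (G.hd e) ∧ lab (G.tl e) < K ∧
        M'.reg 11 = e + 1 ∧ M'.reg 12 = rem (G.hd e) - G.sl e ∧
        ∀ e' < G.E, K ≤ lab (G.hd e') → lab (G.tl e') < K →
          rem (G.hd e) - G.sl e ≤ rem (G.hd e') - G.sl e') := by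
  refine (Runs.seq' (T₁ := 1) (R := fun M' => Mem G lab rem c vote ρ K T M' ∧
    M'.reg 15 = M.reg 15 ∧ M'.reg 11 = 0) (runs_of_wp (by simp [wp, h.setReg])) ?_
    (T₂ := G.E * 20 + 2)).mono (by omega) (fun _ h => h)
  rintro M₁ ⟨h₁, h15, h11⟩
  have hE := h₁.E
  refine (Runs.forDown (fun i M' => Mem G lab rem c vote ρ K T M' ∧ M'.reg 15 = M.reg 15 ∧
      (M'.reg 11 = 0 ∧ (∀ e < G.E, i ≤ e → K ≤ lab (G.hd e) → ¬ lab (G.tl e) < K) ∨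
        ∃ e < G.E, K ≤ lab (G.hd e) ∧ lab (G.tl e) < K ∧
          M'.reg 11 = e + 1 ∧ M'.reg 12 = rem (G.hd e) - G.sl e ∧
          ∀ e' < G.E, i ≤ e' → K ≤ lab (G.hd e') → lab (G.tl e') < K →
            rem (G.hd e) - G.sl e ≤ rem (G.hd e') - G.sl e')) 18 ?_ ?_ ?_ ?_).mono
      (by rw [hE]) ?_
  · rintro j M' v ⟨h1, h2⟩
    exact ⟨h1.setReg (by omega) _, by simpa using h2⟩
  · exact fun j M' h => h.1.one
  · refine ⟨h₁, h15, .inl ⟨h11, fun e he => ?_⟩⟩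
    rw [h₁.E]; omega
  · rintro j M' hj hjn ⟨h1, h2, h3⟩
    rw [h₁.E] at hjn
    have hle : ∀ {e}, j ≤ e → e ≠ j → j + 1 ≤ e := by intros; omega
    refine (runs_of_wp ?_).mono (T := cost _) (by simp [cost]) (fun _ h => h)
    simp only [wp]
    simp only [Memory.reg_setReg, Memory.arr_setReg, hj, h1.top, h1.lab, h1.rem, h1.hd j hjn]
    norm_num only [if_true, if_false]
    simp only [h1.tl j hjn, h1.sl j hjn]
    have skip : ¬ (K ≤ lab (G.hd j) ∧ lab (G.tl j) < K) → ∀ M'' : Memory,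
        M''.reg 11 = M'.reg 11 → M''.reg 12 = M'.reg 12 →
        (M''.reg 11 = 0 ∧ (∀ e < G.E, j ≤ e → K ≤ lab (G.hd e) → ¬ lab (G.tl e) < K) ∨
        ∃ e < G.E, K ≤ lab (G.hd e) ∧ lab (G.tl e) < K ∧
          M''.reg 11 = e + 1 ∧ M''.reg 12 = rem (G.hd e) - G.sl e ∧
          ∀ e' < G.E, j ≤ e' → K ≤ lab (G.hd e') → lab (G.tl e') < K →
            rem (G.hd e) - G.sl e ≤ rem (G.hd e') - G.sl e') := by
      intro hno M'' e1 e2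
      rw [e1, e2]
      rcases h3 with ⟨h3, h4⟩ | ⟨e, he, a1, a2, a3, a4, a5⟩
      · left
        refine ⟨h3, fun e he hje b1 b2 => ?_⟩
        by_cases hej : e = j
        · subst hej; exact hno ⟨b1, b2⟩
        · exact h4 e he (hle hje hej) b1 b2
      · right
        refine ⟨e, he, a1, a2, a3, a4, fun e' he' hje b1 b2 => ?_⟩
        by_cases hej : e' = j
        · subst hej; exact absurd ⟨b1, b2⟩ hno
        · exact a5 e' he' (hle hje hej) b1 b2
    -- The branches: head below the top; an entering edge that beats the current best; one that does
    -- not; the first entering edge found; tail not below the top.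
    refine ⟨fun hx => ⟨⟨?_, by simpa using h2, skip (by omega) _ (by simp) (by simp)⟩,
        by simp⟩,
      fun hx => ⟨fun hy => ⟨fun hz => ⟨fun hw => ?_, fun hw => ?_⟩, fun hz => ⟨fun _ => ?_,
        fun hw => absurd hw (by simp)⟩⟩,
        fun hy => ⟨⟨?_, by simpa using h2, skip (by omega) _ (by simp) (by simp)⟩,
          by simp⟩⟩⟩
    · repeat' apply Mem.setReg
      all_goals first | assumption | omega
    · refine ⟨⟨?_, by simpa using h2, .inr ⟨j, hjn, by omega, by omega, by simp, by simp, ?_⟩⟩,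
        by simp⟩
      · repeat' apply Mem.setReg
        all_goals first | assumption | omega
      · rcases h3 with ⟨h3, h4⟩ | ⟨e, he, a1, a2, a3, a4, a5⟩
        · omega
        · intro e' he' hje b1 b2
          by_cases hej : e' = j
          · rw [hej]
          · have := a5 e' he' (hle hje hej) b1 b2
            omega
    · refine ⟨⟨?_, by simpa using h2, .inr ?_⟩, by simp⟩
      · repeat' apply Mem.setReg
        all_goals first | assumption | omega
      · rcases h3 with ⟨h3, h4⟩ | ⟨e, he, a1, a2, a3, a4, a5⟩
        · omega
        · refine ⟨e, he, a1, a2, by simpa using a3, by simpa using a4, ?_⟩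
          intro e' he' hje b1 b2
          by_cases hej : e' = j
          · rw [hej]
            omega
          · exact a5 e' he' (hle hje hej) b1 b2
    · refine ⟨⟨?_, by simpa using h2, .inr ⟨j, hjn, by omega, by omega, by simp, by simp, ?_⟩⟩,
        by simp⟩
      · repeat' apply Mem.setReg
        all_goals first | assumption | omega
      · rcases h3 with ⟨h3, h4⟩ | ⟨e, he, a1, a2, a3, a4, a5⟩
        · intro e' he' hje b1 b2
          by_cases hej : e' = j
          · rw [hej]
          · exact absurd b2 (h4 e' he' (hle hje hej) b1)
        · omega
    · repeat' apply Mem.setReg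
      all_goals first | assumption | omega
  · rintro M' ⟨h1, h2, h3⟩
    refine ⟨h1, h2, ?_⟩
    rcases h3 with ⟨h3, h4⟩ | ⟨e, he, a1, a2, a3, a4, a5⟩
    · obtain ⟨e, he, b1, b2⟩ := hex
      exact absurd b2 (h4 e he (by omega) b1)
    · exact ⟨e, he, a1, a2, a3, a4, fun e' he' => a5 e' he' (by omega)⟩

/-- The edge `reg 11 - 1` is recorded as chosen. Registers `13` and `14` are set to its tail
and the label of the tail. -/
def pushProg : Prog :=
  .seq (.sub 11 11 0) (.seq (.store 7 4 11) (.seq (.succ 4 4) (.seq (.load 13 2 11)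
    (.load 14 6 13))))

theorem pushProg_runs (h : Mem G lab rem c vote ρ K T M) {e : ℕ} (he : e < G.E)
    (h11 : M.reg 11 = e + 1) :
    Runs pushProg M 5 (fun M' => Mem G lab rem (Function.update c T e) vote ρ K (T + 1) M' ∧
      M'.reg 15 = M.reg 15 ∧ M'.reg 12 = M.reg 12 ∧ M'.reg 13 = G.tl e ∧
      M'.reg 14 = lab (G.tl e)) := by
  obtain ⟨h1, h2, h3, h4, h5, h6, h7, h8, h9, h10, h11, h12, h13⟩ := h
  refine (runs_of_wp ?_).mono (T := cost _) (by simp [cost, pushProg]) (fun _ h => h)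
  simp only [wp, pushProg]
  refine ⟨?_, ?_⟩
  · constructor <;> simp_all
  · simp_all

/-- The remaining capacities of the vertices of the top component are decreased by `reg 12`. -/
def decreaseProg : Prog :=
  .forDown 5 1 (.seq (.load 6 6 5) (.seq (.sub 6 3 6) (.ite 6 .skip
    (.seq (.load 6 5 5) (.seq (.sub 6 6 12) (.store 5 5 6))))))

/-- By `hK`, a vanishing difference `K - lab v` means that `v` lies in the top component. -/
theorem decreaseProg_runs (h : Mem G lab rem c vote ρ K T M) (hK : ∀ v < G.n, lab v ≤ K) :
    Runs decreaseProg M (10 * G.n + 2) (fun M' => Mem G lab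
      (fun v => if v < G.n ∧ lab v = K then rem v - M.reg 12 else rem v) c vote ρ K T M' ∧
      M'.reg 15 = M.reg 15 ∧ M'.reg 13 = M.reg 13 ∧ M'.reg 14 = M.reg 14) := by
  have hn := h.n
  refine (Runs.forDown (fun i M' => Mem G lab
      (fun v => if i ≤ v ∧ v < G.n ∧ lab v = K then rem v - M.reg 12 else rem v) c vote ρ K T M' ∧
      M'.reg 15 = M.reg 15 ∧ M'.reg 13 = M.reg 13 ∧ M'.reg 14 = M.reg 14 ∧
      M'.reg 12 = M.reg 12) 8 ?_ ?_ ?_ ?_).mono (by rw [hn]; omega) ?_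
  · rintro j M' v ⟨h1, h2⟩
    exact ⟨h1.setReg (by omega) _, by simpa using h2⟩
  · exact fun j M' h => h.1.one
  · refine ⟨?_, by simp⟩
    convert h using 1
    funext v
    rw [if_neg]
    rw [h.n]; omega
  · rintro j M' hj hjn ⟨h1, h2, h3, h4, h5⟩
    rw [h.n] at hjn
    refine (runs_of_wp ?_).mono (T := cost _) (by simp [cost]) (fun _ h => h)
    simp only [wp]
    simp only [Memory.reg_setReg, Memory.arr_setReg, hj, h1.top, h1.lab, h1.rem]
    norm_num only [if_true, if_false]
    have hKj := hK j hjn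
    refine ⟨fun hx => ⟨⟨?_, by simpa using ⟨h2, h3, h4, h5⟩⟩, by simp⟩,
      fun hx => ⟨⟨?_, by simpa using ⟨h2, h3, h4, h5⟩⟩, by simpa using hj⟩⟩
    · have : (fun v => if j ≤ v ∧ v < G.n ∧ lab v = K then rem v - M.reg 12 else rem v) =
          (fun v => if j + 1 ≤ v ∧ v < G.n ∧ lab v = K then rem v - M.reg 12 else rem v) := by
        funext v
        refine if_congr ⟨fun h => ⟨?_, h.2⟩, fun h => ⟨by omega, h.2⟩⟩ rfl rfl
        refine lt_of_le_of_ne h.1 ?_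
        rintro rfl
        omega
      rw [this]
      exact (h1.setReg (by omega) _).setReg (by omega) _
    · have hlab : lab j = K := by omega
      have : (fun v => if j ≤ v ∧ v < G.n ∧ lab v = K then rem v - M.reg 12 else rem v) =
          Function.update (fun v => if j + 1 ≤ v ∧ v < G.n ∧ lab v = K then rem v - M.reg 12
            else rem v) j (rem j - M.reg 12) := by
        funext v
        rw [Function.update_apply]
        by_cases hv : v = j
        · subst hv; simp [hjn, hlab]
        · rw [if_neg hv]
          exact if_congr ⟨fun h => ⟨by omega, h.2⟩, fun h => ⟨by omega, h.2⟩⟩ rfl rfl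
      rw [this]
      obtain ⟨h1, h2, h3, h4, h5, h6, h7, h8, h9, h10, h11, h12, h13⟩ := h1
      constructor <;> simp_all
  · rintro M' ⟨h1, h2, h3, h4, h5⟩
    exact ⟨by simpa using h1, h2, h3, h4⟩

/-- The labels that exceed `j = reg 14` are replaced by `j`. -/
def mergeProg : Prog :=
  .seq (.forDown 5 1 (.seq (.load 6 6 5) (.seq (.sub 6 6 14) (.ite 6 (.store 6 5 14) .skip))))
    (.copy 3 14)

theorem mergeProg_runs (h : Mem G lab rem c vote ρ K T M) :
    Runs mergeProg M (10 * G.n + 3) (fun M' => Mem G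
      (fun v => if v < G.n then min (lab v) (M.reg 14) else lab v) rem c vote ρ (M.reg 14) T M' ∧
      M'.reg 15 = M.reg 15) := by
  refine (Runs.seq' (T₁ := G.n * 6 + 2) (R := fun M' => Mem G
      (fun v => if v < G.n then min (lab v) (M.reg 14) else lab v) rem c vote ρ K T M' ∧
      M'.reg 15 = M.reg 15 ∧ M'.reg 14 = M.reg 14) (T₂ := 1) ?_ ?_).mono
      (by omega) (fun _ h => h)
  · have hn := h.n
    refine (Runs.forDown (fun i M' => Mem G
        (fun v => if i ≤ v ∧ v < G.n then min (lab v) (M.reg 14) else lab v) rem c vote ρ K T M' ∧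
        M'.reg 15 = M.reg 15 ∧ M'.reg 14 = M.reg 14) 4 ?_ ?_ ?_ ?_).mono (by rw [hn]) ?_
    · rintro j M' v ⟨h1, h2⟩
      exact ⟨h1.setReg (by omega) _, by simpa using h2⟩
    · exact fun j M' h => h.1.one
    · refine ⟨?_, by simp⟩
      convert h using 1
      funext v
      rw [if_neg]
      rw [h.n]; omega
    · rintro j M' hj hjn ⟨h1, h2, h3⟩
      rw [h.n] at hjn
      refine (runs_of_wp ?_).mono (T := cost _) (by simp [cost]) (fun _ h => h)
      simp only [wp]
      simp only [Memory.reg_setReg, hj, h1.lab, h3]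
      norm_num only [if_true, if_false]
      rw [if_neg (by omega)]
      have key : (fun v => if j ≤ v ∧ v < G.n then min (lab v) (M.reg 14) else lab v) =
            Function.update (fun v => if j + 1 ≤ v ∧ v < G.n then min (lab v) (M.reg 14)
              else lab v) j (min (lab j) (M.reg 14)) := by
        funext v
        rw [Function.update_apply]
        by_cases hv : v = j
        · subst hv; simp [hjn]
        · rw [if_neg hv]
          exact if_congr ⟨fun h => ⟨by omega, h.2⟩, fun h => ⟨by omega, h.2⟩⟩ rfl rfl
      refine ⟨fun hx => ⟨⟨?_, by simp [h2, h3]⟩, by simpa using hj⟩,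
        fun hx => ⟨⟨?_, by simp [h2]⟩, by simp⟩⟩
      · rw [key, min_eq_right (by omega)]
        obtain ⟨h1, h2, h3, h4, h5, h6, h7, h8, h9, h10, h11, h12, h13⟩ := h1
        constructor <;> simp_all
      · rw [key, min_eq_left (by omega), Function.update_eq_self_iff.2]
        · exact (h1.setReg (by omega) _).setReg (by omega) _
        · rw [if_neg (by omega)]
    · rintro M' ⟨h1, h2, h3⟩
      exact ⟨by simpa using h1, h2, h3⟩
  · rintro M₁ ⟨h1, h2, h3⟩
    refine (runs_of_wp ?_).mono (T := cost _) (by simp [cost]) (fun _ h => h)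
    simp only [wp]
    refine ⟨?_, by simpa using h2⟩
    obtain ⟨h1, h2, h3, h4, h5, h6, h7, h8, h9, h10, h11, h12, h13⟩ := h1
    constructor <;> simp_all

/-- A new top component, consisting of the vertex `reg 13`, is added to the path. -/
def extendProg : Prog := .seq (.succ 3 3) (.store 6 13 3)

theorem extendProg_runs (h : Mem G lab rem c vote ρ K T M) :
    Runs extendProg M 2 (fun M' => Mem G (Function.update lab (M.reg 13) (K + 1)) rem c vote ρ
      (K + 1) T M' ∧ M'.reg 15 = M.reg 15) := by
  refine (runs_of_wp ?_).mono (T := cost _) (by simp [cost, extendProg]) (fun _ h => h)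
  simp only [wp, extendProg]
  refine ⟨?_, by simp⟩
  obtain ⟨h1, h2, h3, h4, h5, h6, h7, h8, h9, h10, h11, h12, h13⟩ := h
  constructor <;> simp_all

end SmartVoting

/-! ### The two phases as programs. -/

namespace SmartVoting

open RAM EdgeData

/-- A new path is started if there is a vertex that was not visited; otherwise the flag `reg 15`
is cleared. -/
def startProg : Prog :=
  .seq findProg (.ite 7 (.seq (.sub 7 7 0) (.seq (.const 3 2) (.store 6 7 3))) (.const 15 0))

def stepProg : Prog :=
  .seq scanProg (.seq pushProg (.seq decreaseProg (.ite 14 mergeProg extendProg)))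

/-- The first phase: dual ascent. -/
def ascentProg : Prog :=
  .seq (.const 15 1) (.loop 15 (.seq (.sub 6 3 0) (.ite 6 stepProg startProg)))

variable {G : EdgeData} {lab rem c vote ρ y : ℕ → ℕ} {S : ℕ → Finset ℕ} {K T : ℕ} {M : Memory}

/-- The number of vertices that were not visited. -/
def unvisited (G : EdgeData) (lab : ℕ → ℕ) : ℕ :=
  ((Finset.range G.n).filter (fun v => lab v = 0)).card

theorem unvisited_update {x k : ℕ} (hx : x < G.n) (h0 : lab x = 0) (hk : k ≠ 0) :
    unvisited G (Function.update lab x k) + 1 = unvisited G lab := by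
  have : (Finset.range G.n).filter (fun v => lab v = 0) =
      insert x ((Finset.range G.n).filter (fun v => Function.update lab x k v = 0)) := by
    ext v
    simp only [Finset.mem_filter, Finset.mem_range, Finset.mem_insert, Function.update_apply]
    by_cases hv : v = x
    · simp [hv, hx, h0]
    · simp [hv]
  rw [unvisited, unvisited, this, Finset.card_insert_of_notMem (by simp [hk])]

theorem startProg_runs (h : Mem G lab rem c vote ρ 1 T M) (hL : G.Labelled lab 1 T c S) :
    Runs startProg M (10 * G.n + 10) (fun M' =>
      (∃ lab', Mem G lab' rem c vote ρ 2 T M' ∧ G.Labelled lab' 2 T c S ∧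
        M'.reg 15 = M.reg 15 ∧ unvisited G lab' + 1 = unvisited G lab) ∨
      Mem G lab rem c vote ρ 1 T M' ∧ M'.reg 15 = 0 ∧ ∀ v < G.n, lab v ≠ 0) := by
  refine (Runs.seq' (findProg_runs h) (T₂ := 4) ?_).mono (by omega) (fun _ h => h)
  rintro M₁ ⟨h1, h15, h7⟩
  refine (runs_of_wp ?_).mono (T := cost _) (by simp [cost]) (fun _ h => h)
  simp only [wp]
  rcases h7 with ⟨h7, hall⟩ | ⟨x, hx, h7, hx0⟩
  · refine ⟨fun h => absurd h7 h, fun _ => .inr ⟨h1.setReg (by omega) _, by simp, hall⟩⟩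
  · refine ⟨fun _ => .inl ⟨Function.update lab x 2, ?_, hL.start hx hx0, by simpa using h15,
      unvisited_update hx hx0 (by omega)⟩, by omega⟩
    obtain ⟨h1, h2, h3, h4, h5, h6, h7', h8, h9, h10, h11, h12, h13⟩ := h1
    constructor <;> simp_all

/-- The potential drops in both cases: a merge lowers `K` and visits nothing new, while an extension
raises `K` by one but uses up an unvisited vertex, which counts twice. -/
theorem stepProg_runs (hG : G.WF) (h : Mem G lab rem c vote ρ K T M)
    (hL : G.Labelled lab K T c S) (hH : G.History rem T c S y) (hK : 2 ≤ K) :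
    Runs stepProg M (20 * G.E + 20 * G.n + 20) (fun M' =>
      ∃ lab' rem' c' S' y' K', Mem G lab' rem' c' vote ρ K' (T + 1) M' ∧
        G.Labelled lab' K' (T + 1) c' S' ∧ G.History rem' (T + 1) c' S' y' ∧
        M'.reg 15 = M.reg 15 ∧ 2 * unvisited G lab' + K' < 2 * unvisited G lab + K) := by
  have hle := hL.le_top
  have hiff : ∀ e < G.E, (K ≤ lab (G.hd e) ∧ lab (G.tl e) < K) ↔
      (lab (G.hd e) = K ∧ lab (G.tl e) ≠ K) := by
    intro e he
    have h1 := hle _ (hG.hd_lt e he).le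
    have h2 := hle _ (hG.tl_le e he)
    omega
  have hex : ∃ e < G.E, K ≤ lab (G.hd e) ∧ lab (G.tl e) < K := by
    obtain ⟨e, he, h1⟩ := hL.exists_enters hG hK
    exact ⟨e, he, (hiff e he).2 h1⟩
  refine (Runs.seq' (scanProg_runs h hex)
    (T₂ := 5 + ((10 * G.n + 2) + (1 + (10 * G.n + 3)))) ?_).mono (by omega) (fun _ h => h)
  rintro M₁ ⟨h₁, h15, e, he, e1, e2, h11, h12, hmin⟩
  refine Runs.seq' (pushProg_runs h₁ he h11) ?_
  rintro M₂ ⟨h₂, h15', h12', h13, h14⟩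
  refine Runs.seq' (decreaseProg_runs h₂ (fun v hv => hle v hv.le)) ?_
  rintro M₃ ⟨h₃, h15'', h13', h14'⟩
  rw [h12', h12] at h₃
  rw [h13] at h13'
  rw [h14] at h14'
  obtain ⟨e1', e2'⟩ := (hiff e he).1 ⟨e1, e2⟩
  have hpush := hH.push hG hL hK he e1' e2' (fun e' he' b1 b2 =>
    hmin e' he' ((hiff e' he').2 ⟨b1, b2⟩).1 ((hiff e' he').2 ⟨b1, b2⟩).2)
  refine Runs.ite (fun hx => ?_) (fun hx => ?_)
  · refine (mergeProg_runs h₃).mono le_rfl ?_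
    rintro M₄ ⟨h₄, h15₄⟩
    rw [h14'] at h₄ hx
    refine ⟨_, _, _, _, _, _, h₄, hL.merge hG hH hK he e1' hx ?_, hpush, by omega, ?_⟩
    · intro v hv
      split_ifs with hvn
      · rfl
      · have : v = G.n := by omega
        rw [this, hL.root]; omega
    · have : unvisited G (fun v => if v < G.n then min (lab v) (lab (G.tl e)) else lab v) =
          unvisited G lab := by
        rw [unvisited, unvisited]
        congr 1
        refine Finset.filter_congr fun v hv => ?_
        rw [Finset.mem_range] at hv
        simp only [hv, if_true]
        omega
      rw [this]; omega
  · refine (extendProg_runs h₃).mono (by omega) ?_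
    rintro M₄ ⟨h₄, h15₄⟩
    rw [h13'] at h₄
    rw [h14'] at hx
    refine ⟨_, _, _, _, _, _, h₄, hL.extend hG hH hK he e1' hx, hpush, by omega, ?_⟩
    have := unvisited_update (G := G) (lab := lab) (x := G.tl e) (k := K + 1)
      (lt_of_le_of_ne (hG.tl_le e he) (by intro h; rw [h, hL.root] at hx; omega)) hx (by omega)
    omega

/-- `hT` is maintained because only proper steps advance `T` and each of them lowers the potential.
At the end `K = 1`, which leaves `T ≤ 2 * n`. -/
theorem ascentProg_runs (hG : G.WF) (h : Mem G lab rem c vote ρ K T M)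
    (hL : G.Labelled lab K T c S) (hH : G.History rem T c S y)
    (hT : T + (2 * unvisited G lab + K) ≤ 2 * G.n + 1) :
    Runs ascentProg M ((2 * G.n + 2) * (20 * G.E + 20 * G.n + 30) + 2) (fun M' =>
      ∃ lab' rem' c' S' y' T', Mem G lab' rem' c' vote ρ 1 T' M' ∧ G.Labelled lab' 1 T' c' S' ∧
        G.History rem' T' c' S' y' ∧ T' ≤ 2 * G.n ∧ ∀ v < G.n, lab' v = 1) := by
  refine (Runs.seq' (T₁ := 1) (R := fun M' => M'.reg 15 = 1 ∧ Mem G lab rem c vote ρ K T M')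
    (runs_of_wp (by simp [wp, h.setReg])) (T₂ := (2 * G.n + 2) * (20 * G.E + 20 * G.n + 30) + 1)
    ?_).mono (by omega) (fun _ h => h)
  rintro M₁ ⟨h15, h₁⟩
  refine (Runs.loop (fun M' => ∃ lab rem c S y K T, Mem G lab rem c vote ρ K T M' ∧
      G.Labelled lab K T c S ∧ G.History rem T c S y ∧
      T + (2 * unvisited G lab + K) ≤ 2 * G.n + 1 ∧ M'.reg 15 ≤ 1 ∧
      (M'.reg 15 = 0 → K = 1 ∧ ∀ v < G.n, lab v ≠ 0))
    -- The flag is included so that the last round, which only clears it, decreases the measure too.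
    (fun M' => 2 * unvisited G (M'.arr 6) + M'.reg 3 + M'.reg 15) (20 * G.E + 20 * G.n + 29)
    ?_ (b := 2 * G.n + 2) ⟨lab, rem, c, S, y, K, T, h₁, hL, hH, hT, h15.le, by omega⟩ ?_).mono
    le_rfl ?_
  · rintro M ⟨lab, rem, c, S, y, K, T, h, hL, hH, hT, h15, -⟩ hx
    have h15 : M.reg 15 = 1 := by omega
    have hK1 := hL.one_le
    rw [h.lab, h.top]
    refine (Runs.seq' (T₁ := 1) (R := fun M' => M'.reg 6 = K - 1 ∧ M'.reg 15 = 1 ∧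
      Mem G lab rem c vote ρ K T M')
      (runs_of_wp (by simp [wp, h.setReg, h.top, h.one, h15]))
      (T₂ := 1 + (20 * G.E + 20 * G.n + 20)) ?_).mono (by omega) (fun _ h => h)
    rintro M₂ ⟨h6, h15₂, h₂⟩
    refine Runs.ite (fun hx => ?_) (fun hx => ?_)
    · refine (stepProg_runs hG h₂ hL hH (by omega)).mono le_rfl ?_
      rintro M₃ ⟨lab', rem', c', S', y', K', a1, a2, a3, a4, a5⟩
      rw [a1.lab, a1.top]
      exact ⟨⟨lab', rem', c', S', y', K', _, a1, a2, a3, by omega, by omega, by omega⟩, by omega⟩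
    · obtain rfl : K = 1 := by omega
      refine (startProg_runs h₂ hL).mono (by omega) ?_
      rintro M₃ (⟨lab', a1, a2, a3, a4⟩ | ⟨a1, a2, a3⟩)
      · rw [a1.lab, a1.top]
        exact ⟨⟨lab', _, _, _, _, _, _, a1, a2, hH, by omega, by omega, by omega⟩, by omega⟩
      · rw [a1.lab, a1.top]
        exact ⟨⟨lab, _, _, _, _, _, _, a1, hL, hH, hT, by omega, fun _ => ⟨rfl, a3⟩⟩, by omega⟩
  · rw [h₁.lab, h₁.top]; omega
  · rintro M' ⟨⟨lab, rem, c, S, y, K, T, h, hL, hH, hT, -, h0⟩, h15⟩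
    obtain ⟨rfl, hall⟩ := h0 h15
    refine ⟨lab, rem, c, S, y, T, h, hL, hH, by omega, fun v hv => ?_⟩
    have h1 := hL.le_top v hv.le
    have h2 := hall v hv
    omega

/-- Register `11` is set to the first chosen edge from a reached vertex to one that was not
reached. -/
def firstProg : Prog :=
  .forDown 5 4 (.seq (.load 6 7 5) (.seq (.load 7 2 6) (.seq (.load 8 8 7) (.ite 8
    (.seq (.load 7 3 6) (.seq (.load 7 8 7) (.ite 7 .skip (.copy 11 6)))) .skip))))

/-- Times are scanned downwards and register `11` is overwritten at every hit, so the earliest hit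
survives. -/
theorem firstProg_runs (h : Mem G lab rem c vote ρ K T M) (hc : ∀ t < T, c t < G.E)
    (hex : ∃ t < T, ρ (G.tl (c t)) ≠ 0 ∧ ρ (G.hd (c t)) = 0) :
    Runs firstProg M (10 * T + 2) (fun M' => Mem G lab rem c vote ρ K T M' ∧
      M'.reg 15 = M.reg 15 ∧ M'.reg 14 = M.reg 14 ∧ ∃ t < T, M'.reg 11 = c t ∧
        ρ (G.tl (c t)) ≠ 0 ∧ ρ (G.hd (c t)) = 0 ∧
        ∀ t' < t, ¬ (ρ (G.tl (c t')) ≠ 0 ∧ ρ (G.hd (c t')) = 0)) := by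
  have hT := h.time
  refine (Runs.forDown (fun i M' => Mem G lab rem c vote ρ K T M' ∧ M'.reg 15 = M.reg 15 ∧
      M'.reg 14 = M.reg 14 ∧ ((∀ t < T, i ≤ t → ¬ (ρ (G.tl (c t)) ≠ 0 ∧ ρ (G.hd (c t)) = 0)) ∨
      ∃ t < T, M'.reg 11 = c t ∧ ρ (G.tl (c t)) ≠ 0 ∧ ρ (G.hd (c t)) = 0 ∧
        ∀ t' < t, i ≤ t' → ¬ (ρ (G.tl (c t')) ≠ 0 ∧ ρ (G.hd (c t')) = 0))) 8
      ?_ ?_ ?_ ?_).mono (by rw [hT]; omega) ?_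
  · rintro j M' v ⟨h1, h2⟩
    exact ⟨h1.setReg (by omega) _, by simpa using h2⟩
  · exact fun j M' h => h.1.one
  · refine ⟨h, rfl, rfl, .inl fun t ht htT => ?_⟩
    omega
  · rintro j M' hj hjT ⟨h1, h2, h3, h4⟩
    rw [hT] at hjT
    have hle : ∀ {e}, j ≤ e → e ≠ j → j + 1 ≤ e := by intros; omega
    refine (runs_of_wp ?_).mono (T := cost _) (by simp [cost]) (fun _ h => h)
    simp only [wp]
    simp only [Memory.reg_setReg, Memory.arr_setReg, hj, h1.c, h1.reached]
    norm_num only [if_true, if_false]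
    simp only [h1.tl _ (hc j hjT), h1.hd _ (hc j hjT)]
    have skip : ¬ (ρ (G.tl (c j)) ≠ 0 ∧ ρ (G.hd (c j)) = 0) → ∀ M'' : Memory,
        M''.reg 11 = M'.reg 11 →
        ((∀ t < T, j ≤ t → ¬ (ρ (G.tl (c t)) ≠ 0 ∧ ρ (G.hd (c t)) = 0)) ∨
      ∃ t < T, M''.reg 11 = c t ∧ ρ (G.tl (c t)) ≠ 0 ∧ ρ (G.hd (c t)) = 0 ∧
        ∀ t' < t, j ≤ t' → ¬ (ρ (G.tl (c t')) ≠ 0 ∧ ρ (G.hd (c t')) = 0)) := by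
      intro hno M'' e1
      rw [e1]
      have key : ∀ t, j ≤ t → (j + 1 ≤ t → ¬ (ρ (G.tl (c t)) ≠ 0 ∧ ρ (G.hd (c t)) = 0)) →
          ¬ (ρ (G.tl (c t)) ≠ 0 ∧ ρ (G.hd (c t)) = 0) := by
        intro t hjt ht
        by_cases htj : t = j
        · rw [htj]; exact hno
        · exact ht (hle hjt htj)
      rcases h4 with h4 | ⟨t, ht, a1, a2, a3, a4⟩
      · exact .inl fun t ht hjt => key t hjt (h4 t ht)
      · exact .inr ⟨t, ht, a1, a2, a3, fun t' ht' hjt => key t' hjt (a4 t' ht')⟩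
    refine ⟨fun hx => ⟨fun hy => ?_, fun hy => ?_⟩, fun hx => ?_⟩
    · refine ⟨⟨?_, by simpa using h2, by simpa using h3, skip (fun h => hy h.2) _ (by simp)⟩,
        by simp⟩
      repeat' apply Mem.setReg
      all_goals first | assumption | omega
    · refine ⟨⟨?_, by simpa using h2, by simpa using h3, .inr ⟨j, hjT, by simp, hx, hy, ?_⟩⟩,
        by simp⟩
      · repeat' apply Mem.setReg
        all_goals first | assumption | omega
      · intros; omega
    · refine ⟨⟨?_, by simpa using h2, by simpa using h3, skip (fun h => h.1 hx) _ (by simp)⟩,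
        by simp⟩
      repeat' apply Mem.setReg
      all_goals first | assumption | omega
  · rintro M' ⟨h1, h2, h3, h4⟩
    refine ⟨h1, h2, h3, ?_⟩
    rcases h4 with h4 | ⟨t, ht, a1, a2, a3, a4⟩
    · obtain ⟨t, ht, h5⟩ := hex
      exact absurd h5 (h4 t ht (by omega))
    · exact ⟨t, ht, a1, a2, a3, fun t' ht' => a4 t' ht' (by omega)⟩

/-- The edge `reg 11` is added to the tree. -/
def reachProg : Prog :=
  .seq (.load 6 2 11) (.seq (.load 7 3 11) (.seq (.store 8 7 14) (.seq (.sub 8 1 6)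
    (.ite 8 (.seq (.load 8 1 6) (.store 1 7 8)) .skip))))

theorem reachProg_runs (h : Mem G lab rem c vote ρ K T M) {e : ℕ} (he : e < G.E)
    (hle : G.tl e ≤ G.n) (h11 : M.reg 11 = e) :
    Runs reachProg M 10 (fun M' => Mem G lab rem c
      (if G.tl e = G.n then vote else Function.update vote (G.hd e) (vote (G.tl e)))
      (Function.update ρ (G.hd e) (M.reg 14)) K T M' ∧
      M'.reg 15 = M.reg 15 ∧ M'.reg 14 = M.reg 14) := by
  refine (runs_of_wp ?_).mono (T := cost _) (by simp [cost, reachProg]) (fun _ h => h)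
  simp only [wp, reachProg]
  simp only [Memory.reg_setReg, Memory.arr_setReg, Memory.reg_setCell, Memory.arr_setCell,
    h11, h.n]
  norm_num only [if_true, if_false]
  simp only [h.tl _ he, h.hd _ he]
  refine ⟨fun hx => ⟨?_, by simp⟩, fun hx => ⟨?_, by simp⟩⟩
  · rw [if_neg (by omega)]
    obtain ⟨h1, h2, h3, h4, h5, h6, h7', h8, h9, h10, h11, h12, h13⟩ := h
    constructor <;> simp_all
  · rw [if_pos (by omega)]
    obtain ⟨h1, h2, h3, h4, h5, h6, h7', h8, h9, h10, h11, h12, h13⟩ := h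
    constructor <;> simp_all

/-- The second phase: the vertices are reached one after the other, always by the edge that was
chosen first. -/
def treeProg : Prog :=
  .seq (.const 14 0) (.forDown 15 1 (.seq (.succ 14 14) (.seq firstProg reachProg)))

/-- When the counter is `i`, exactly `n - i` vertices have been reached. Rescanning all recorded
edges each time is affordable, as `T` will be at most `2 * n`. -/
theorem treeProg_runs (hG : G.WF) (h : Mem G lab rem c vote ρ K T M)
    (hH : G.History rem T c S y) (hreach : ∀ v < G.n, G.Reach c T G.n v)
    (hρ : ρ G.n ≠ 0) (hρ0 : ∀ v < G.n, ρ v = 0) :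
    Runs treeProg M (G.n * (10 * T + 20) + 3) (fun M' => ∃ ρ' vote' f,
      Mem G lab rem c vote' ρ' K T M' ∧ G.Tree T c S vote G.n ρ' vote' f) := by
  refine (Runs.seq' (T₁ := 1) (R := fun M' => M'.reg 14 = 0 ∧ Mem G lab rem c vote ρ K T M')
    (runs_of_wp (by simp [wp, h.setReg])) (T₂ := G.n * (10 * T + 20) + 2)
    ?_).mono (by omega) (fun _ h => h)
  rintro M₁ ⟨h14, h₁⟩
  have hn := h₁.n
  refine (Runs.forDown (fun i M' => ∃ ρ' vote' f, Mem G lab rem c vote' ρ' K T M' ∧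
    G.Tree T c S vote (G.n - i) ρ' vote' f ∧ M'.reg 14 = G.n - i) (1 + (10 * T + 2 + 10))
    ?_ ?_ ?_ ?_).mono (by rw [hn]; ring_nf; omega) ?_
  · rintro j M' v ⟨ρ', vote', f, h1, h2, h3⟩
    exact ⟨ρ', vote', f, h1.setReg (by omega) _, h2, by simpa using h3⟩
  · rintro j M' ⟨ρ', vote', f, h1, h2, h3⟩
    exact h1.one
  · refine ⟨ρ, vote, fun _ => 0, h₁, ?_, by omega⟩
    rw [hn, Nat.sub_self]
    exact tree_zero _ _ hρ hρ0 hH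
  · rintro j M' hj hjn ⟨ρ', vote', f, h1, h2, h3⟩
    rw [hn] at hjn
    refine Runs.seq' (T₁ := 1) (R := fun M' => M'.reg 14 = G.n - j ∧ M'.reg 15 = j ∧
      Mem G lab rem c vote' ρ' K T M') (runs_of_wp ?_) ?_
    · simp only [wp]
      refine ⟨?_, by simpa using hj, h1.setReg (by omega) _⟩
      rw [Memory.reg_setReg, if_pos rfl]; omega
    rintro M₂ ⟨a1, a2, a3⟩
    refine Runs.seq' (firstProg_runs a3 hH.edge_lt
      (h2.exists_edge (by omega) hreach)) ?_
    rintro M₃ ⟨b1, b2, b3, t, ht, b4, b5, b6, b7⟩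
    refine (reachProg_runs b1 (hH.edge_lt t ht) (hG.tl_le _ (hH.edge_lt t ht)) b4).mono le_rfl ?_
    rintro M₄ ⟨c1, c2, c3⟩
    have := h2.step hG hH ht b5 b6 b7
    rw [show G.n - (j + 1) + 1 = G.n - j by omega] at this
    rw [b3, a1] at c1
    exact ⟨⟨_, _, _, c1, this, by omega⟩, by omega⟩
  · rintro M' ⟨ρ', vote', f, h1, h2, h3⟩
    exact ⟨ρ', vote', f, h1, by simpa using h2⟩

end SmartVoting

/-! ### Reading the ballots and writing the edge lists. -/

namespace SmartVoting

open RAM EdgeData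

/-- The edges into the vertex `a`, as triples `(tail, head, slack)`, if the delegates of `a` are
`ds`. -/
def agentEdges (n a : ℕ) : List ℕ → List (ℕ × ℕ × ℕ)
  | [] => [(n, a, 0)]
  | u :: ds => (u, a, ds.length + 1) :: agentEdges n a ds

theorem length_agentEdges (n a : ℕ) (ds : List ℕ) :
    (agentEdges n a ds).length = ds.length + 1 := by
  induction ds with
  | nil => rfl
  | cons u ds ih => simp [agentEdges, ih]

/-- The ballots of the agents in the list `l`, where the agent `a` has the delegates `ds a` and
the backup vote `bk a`. -/
def ballotsInput (ds : ℕ → List ℕ) (bk : ℕ → ℕ) (l : List ℕ) : List ℕ :=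
  l.flatMap fun a => (ds a).length :: (ds a ++ [bk a])

/-- The contents of the memory while the input is read: `xs` is the unread part of the input,
and `es` is the list of the edges that have been written. -/
structure Reading (n a r : ℕ) (xs : List ℕ) (es : List (ℕ × ℕ × ℕ)) (bk cap : ℕ → ℕ)
    (M : Memory) : Prop where
  one : M.reg 0 = 1
  n : M.reg 1 = n
  agent : M.reg 6 = a
  left : M.reg 7 = r
  input : ∀ j, M.arr 0 (M.reg 5 + j) = xs.getD j 0
  length : M.reg 2 = es.length
  edge : ∀ e < es.length, (M.arr 2 e, M.arr 3 e, M.arr 4 e) = es.getD e (0, 0, 0)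
  vote : ∀ v < a, M.arr 1 v = bk v
  cap : ∀ v < a, M.arr 5 v = cap v
  lab : M.arr 6 = fun _ => 0
  reached : M.arr 8 = fun _ => 0

/-- The edge from `reg 9` to `reg 6` with slack `reg 8` is written. -/
def emitProg : Prog :=
  .seq (.store 2 2 9) (.seq (.store 3 2 6) (.seq (.store 4 2 8) (.succ 2 2)))

/-- Register `8` counts the delegates still to be read, which is the slack of the next edge. It ends
at `0`, the slack of the root edge, so no weight has to be computed. -/
def delegatesProg : Prog :=
  .loop 8 (.seq (.load 9 0 5) (.seq (.succ 5 5) (.seq emitProg (.sub 8 8 0))))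

def agentProg : Prog :=
  .seq (.seq (.load 8 0 5) (.seq (.succ 5 5) (.seq (.succ 9 8) (.store 5 6 9))))
    (.seq delegatesProg (.seq (.copy 9 1) (.seq emitProg
      (.seq (.load 9 0 5) (.seq (.succ 5 5) (.seq (.store 1 6 9) (.seq (.succ 6 6)
        (.sub 7 7 0))))))))

def readProg : Prog :=
  .seq (.seq (.const 0 1) (.seq (.load 1 0 5) (.seq (.succ 5 5) (.copy 7 1))))
    (.seq (.loop 7 agentProg)
      -- Sets up the phases: the root has label `1` and counts as reached, `K = 1` and `T = 0`.
      (.seq (.store 6 1 0) (.seq (.store 8 1 0) (.seq (.const 3 1) (.const 4 0)))))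

variable {n a r : ℕ} {xs : List ℕ} {es : List (ℕ × ℕ × ℕ)} {bk cap : ℕ → ℕ} {M : Memory}

theorem edge_append (es : List (ℕ × ℕ × ℕ)) (x y z : ℕ) {A B C : ℕ → ℕ}
    (h : ∀ e < es.length, (A e, B e, C e) = es.getD e (0, 0, 0)) :
    ∀ e < (es ++ [(x, y, z)]).length, (Function.update A es.length x e,
      Function.update B es.length y e, Function.update C es.length z e) =
        (es ++ [(x, y, z)]).getD e (0, 0, 0) := by
  intro e he
  rw [List.length_append, List.length_singleton] at he
  by_cases h' : e = es.length
  · subst h'; simp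
  · have : e < es.length := by omega
    simp only [Function.update_of_ne h', h e this]
    simp [List.getD_eq_getElem?_getD, List.getElem?_append_left this]

theorem input_tail {A : ℕ → ℕ} {p x : ℕ} (h : ∀ j, A (p + j) = (x :: xs).getD j 0) :
    A p = x ∧ ∀ j, A (p + 1 + j) = xs.getD j 0 := by
  refine ⟨by simpa using h 0, fun j => ?_⟩
  have := h (j + 1)
  rw [List.getD_cons_succ] at this
  rw [← this]
  congr 1
  omega

/-- The root edge is split off because the caller writes it, once the loop has ended. -/
theorem delegatesProg_runs (ds : List ℕ) : ∀ {es : List (ℕ × ℕ × ℕ)} {M : Memory},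
    Reading n a r (ds ++ xs) es bk cap M → M.reg 8 = ds.length → M.arr 5 a = cap a →
    Runs delegatesProg M (10 * ds.length + 1) (fun M' =>
      ∃ es', Reading n a r xs (es ++ es') bk cap M' ∧ M'.reg 8 = 0 ∧ M'.arr 5 a = cap a ∧
        es' ++ [(n, a, 0)] = agentEdges n a ds) := by
  induction ds with
  | nil =>
    intro es M h h8 hcap
    exact Runs.loop_done h8 ⟨[], by simpa using h, h8, hcap, rfl⟩
  | cons u ds ih =>
    intro es M h h8 hcap
    refine (Runs.loop_step (T₁ := 7) (T₂ := 10 * ds.length + 1) (by simp [h8]) ?_).mono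
      (by simp; omega) (fun _ h => h)
    refine Runs.mono (Q := fun M' => Reading n a r (ds ++ xs) (es ++ [(u, a, ds.length + 1)])
      bk cap M' ∧ M'.reg 8 = ds.length ∧ M'.arr 5 a = cap a) ?_ le_rfl ?_
    · refine (runs_of_wp ?_).mono (T := cost _) (by simp [cost, emitProg]) (fun _ h => h)
      simp only [wp, emitProg]
      obtain ⟨h1, h2, h3, h4, h5, h6, h7, h9, h10, h11, h12⟩ := h
      obtain ⟨h5, h5'⟩ := input_tail h5
      refine ⟨⟨?_, ?_, ?_, ?_, ?_, ?_, ?_, ?_, ?_, ?_, ?_⟩, ?_, ?_⟩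
      case refine_7 =>
        have := edge_append es u a (ds.length + 1) h7
        simpa [h8, h5, h6, h3] using this
      all_goals simp_all
    · rintro M' ⟨h, h8, hcap⟩
      refine (ih h h8 hcap).mono le_rfl ?_
      rintro M'' ⟨es', a1, a2, a3, a4⟩
      exact ⟨(u, a, ds.length + 1) :: es', by simpa using a1, a2, a3, by simp [agentEdges, a4]⟩

theorem agentProg_runs (ds : List ℕ) (hcap : cap a = ds.length + 1)
    (h : Reading n a (r + 1) (ds.length :: (ds ++ bk a :: xs)) es bk cap M) :
    Runs agentProg M (10 * ds.length + 20) (fun M' =>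
      Reading n (a + 1) r xs (es ++ agentEdges n a ds) bk cap M') := by
  refine (Runs.seq' (T₁ := 4) (R := fun M' => Reading n a (r + 1) (ds ++ bk a :: xs) es bk cap M' ∧
    M'.reg 8 = ds.length ∧ M'.arr 5 a = cap a) ?_ (T₂ := 10 * ds.length + 1 + 12) ?_).mono
    (by omega) (fun _ h => h)
  · refine (runs_of_wp ?_).mono (T := cost _) (by simp [cost]) (fun _ h => h)
    simp only [wp]
    obtain ⟨h1, h2, h3, h4, h5, h6, h7, h9, h10, h11, h12⟩ := h
    obtain ⟨h5, h5'⟩ := input_tail h5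
    refine ⟨⟨?_, ?_, ?_, ?_, ?_, ?_, ?_, ?_, ?_, ?_, ?_⟩, ?_, ?_⟩
    case refine_9 =>
      intro v hv
      simp [h3, Function.update_of_ne hv.ne, h10 v hv]
    all_goals simp_all
  · rintro M₁ ⟨h₁, h8, h5⟩
    refine Runs.seq' (delegatesProg_runs ds h₁ h8 h5) ?_
    rintro M₂ ⟨es', h₂, h8₂, h5₂, hes⟩
    rw [← hes, ← List.append_assoc]
    refine (runs_of_wp ?_).mono (T := cost _) (by simp [cost, emitProg]) (fun _ h => h)
    simp only [wp, emitProg]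
    obtain ⟨h1, h2, h3, h4, h5, h6, h7, h9, h10, h11, h12⟩ := h₂
    obtain ⟨h5, h5'⟩ := input_tail h5
    refine ⟨?_, ?_, ?_, ?_, ?_, ?_, ?_, ?_, ?_, ?_, ?_⟩
    case refine_7 =>
      have := edge_append (es ++ es') n a 0 h7
      simpa [h8₂, h2, h6, h3] using this
    case refine_8 =>
      intro v hv
      rcases Nat.lt_succ_iff_lt_or_eq.1 hv with hv | rfl
      · simp [h3, Function.update_of_ne hv.ne, h9 v hv]
      · simp [h3, h5]
    case refine_9 =>
      intro v hv
      rcases Nat.lt_succ_iff_lt_or_eq.1 hv with hv | rfl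
      · simp [h10 v hv]
      · simp [h5₂]
    case refine_6 => simp [h6, add_assoc]
    all_goals simp_all

theorem agents_runs (ds : ℕ → List ℕ) (hcap : ∀ v, cap v = (ds v).length + 1) :
    ∀ {r a : ℕ} {es : List (ℕ × ℕ × ℕ)} {M : Memory},
    Reading n a r (ballotsInput ds bk (List.range' a r)) es bk cap M →
    Runs (.loop 7 agentProg) M
      (21 * ((List.range' a r).flatMap fun a => agentEdges n a (ds a)).length + 1) (fun M' =>
      Reading n (a + r) 0 [] (es ++ (List.range' a r).flatMap fun a => agentEdges n a (ds a))
        bk cap M') := by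
  intro r
  induction r with
  | zero =>
    intro a es M h
    refine (Runs.loop_done h.left (Q := fun M' => Reading n (a + 0) 0 []
      (es ++ (List.range' a 0).flatMap fun a => agentEdges n a (ds a)) bk cap M') ?_).mono
      (by simp) (fun _ h => h)
    simpa [ballotsInput] using h
  | succ r ih =>
    intro a es M h
    rw [List.range'_succ]
    rw [List.range'_succ, ballotsInput, List.flatMap_cons, List.cons_append, List.append_assoc,
      List.singleton_append] at h
    refine (Runs.loop_step (by simp [h.left]) ((agentProg_runs (ds a) (hcap a) h).mono le_rfl
      (fun M' h' => ih h'))).mono ?_ ?_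
    · rw [List.flatMap_cons, List.length_append, length_agentEdges]
      omega
    · intro M' h'
      rw [List.flatMap_cons, ← List.append_assoc]
      convert h' using 1
      omega

/-- The graph of the profile in which agent `a` has the delegates `ds a`. -/
def profileGraph (n : ℕ) (ds : ℕ → List ℕ) : EdgeData :=
  let es := (List.range n).flatMap fun a => agentEdges n a (ds a)
  { n := n
    E := es.length
    tl := fun e => (es.getD e (0, 0, 0)).1
    hd := fun e => (es.getD e (0, 0, 0)).2.1
    sl := fun e => (es.getD e (0, 0, 0)).2.2
    cap := fun v => (ds v).length + 1 }

theorem readProg_runs (n : ℕ) (ds : ℕ → List ℕ) (bk : ℕ → ℕ) :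
    Runs readProg (Memory.init (n :: ballotsInput ds bk (List.range n)))
      (21 * (profileGraph n ds).E + 10) (fun M' => ∃ lab rem c vote ρ,
        Mem (profileGraph n ds) lab rem c vote ρ 1 0 M' ∧ lab n = 1 ∧ (∀ v < n, lab v = 0) ∧
        ρ n = 1 ∧ (∀ v < n, ρ v = 0) ∧ (∀ v < n, rem v = (profileGraph n ds).cap v) ∧
        ∀ v < n, vote v = bk v) := by
  refine (Runs.seq' (T₁ := 4) (R := fun M' => Reading n 0 n
    (ballotsInput ds bk (List.range' 0 n)) [] bk (fun v => (ds v).length + 1) M') ?_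
    (T₂ := 21 * (profileGraph n ds).E + 1 + 4) ?_).mono (by omega) (fun _ h => h)
  · refine (runs_of_wp ?_).mono (T := cost _) (by simp [cost]) (fun _ h => h)
    simp only [wp]
    have hin : (Memory.init (n :: ballotsInput ds bk (List.range n))).arr 0 =
      fun i => (n :: ballotsInput ds bk (List.range n)).getD i 0 := by
      simp [Memory.init]
    rw [List.range_eq_range'] at hin ⊢
    constructor <;> simp [Memory.init, add_comm 1]
  · intro M₁ h₁
    refine Runs.seq' (T₁ := 21 * (profileGraph n ds).E + 1) ?_ (T₂ := 4) (fun M' h' => h')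
      (R := fun M' => Runs _ M' 4 _)
    refine (agents_runs ds (fun _ => rfl) h₁).mono
      (by simp only [profileGraph, List.range_eq_range']; exact le_rfl) ?_
    intro M₂ h₂
    rw [List.nil_append, zero_add, ← List.range_eq_range'] at h₂
    refine (runs_of_wp ?_).mono (T := cost _) (by simp [cost]) (fun _ h => h)
    simp only [wp]
    obtain ⟨h1, h2, h3, h4, h5, h6, h7, h9, h10, h11, h12⟩ := h₂
    refine ⟨_, _, _, _, _, ⟨?_, ?_, ?_, ?_, ?_, rfl, ?_, ?_, ?_, rfl, rfl, rfl, rfl⟩,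
      ?_, ?_, ?_, ?_, ?_, ?_⟩
    case refine_6 => exact fun e he => congrArg Prod.fst (h7 e he)
    case refine_7 => exact fun e he => congrArg (fun p => p.2.1) (h7 e he)
    case refine_8 => exact fun e he => congrArg (fun p => p.2.2) (h7 e he)
    case refine_10 =>
      intro v hv
      simp [h1, h2, h11, Function.update_of_ne hv.ne]
    case refine_12 =>
      intro v hv
      simp [h1, h2, h12, Function.update_of_ne hv.ne]
    case refine_13 => exact fun v hv => h10 v hv
    case refine_14 => exact fun v hv => by simpa using h9 v hv
    all_goals simp [h1, h2, h6, profileGraph]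

end SmartVoting

/-! ### Edges as preference levels, and the running time. -/

namespace SmartVoting

open RAM EdgeData

/-- The delegate at index `i` has slack `ds.length - i`. With capacity `ds.length + 1` its edge has
weight `i + 1`, its preference level. -/
theorem mem_agentEdges {n a t h s : ℕ} {ds : List ℕ} :
    (t, h, s) ∈ agentEdges n a ds ↔
      h = a ∧ (t = n ∧ s = 0 ∨ ∃ i, ds[i]? = some t ∧ s + i = ds.length) := by
  induction ds with
  | nil => simp [agentEdges]; tauto
  | cons u ds ih =>
    rw [agentEdges, List.mem_cons, ih]
    constructor
    · rintro (h' | ⟨rfl, h' | ⟨i, h1, h2⟩⟩)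
      · simp only [Prod.mk.injEq] at h'
        obtain ⟨rfl, rfl, rfl⟩ := h'
        exact ⟨rfl, .inr ⟨0, by simp, by simp⟩⟩
      · exact ⟨rfl, .inl h'⟩
      · exact ⟨rfl, .inr ⟨i + 1, by simpa using h1, by simp; omega⟩⟩
    · rintro ⟨rfl, h' | ⟨i, h1, h2⟩⟩
      · exact .inr ⟨rfl, .inl h'⟩
      · cases i with
        | zero => left; simp_all
        | succ i => exact .inr ⟨rfl, .inr ⟨i, by simpa using h1, by simp at h2; omega⟩⟩

section profileGraph

variable {n : ℕ} {ds : ℕ → List ℕ}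

theorem profileGraph_edge {e : ℕ} (he : e < (profileGraph n ds).E) :
    (profileGraph n ds).hd e < n ∧
      ((profileGraph n ds).tl e = n ∧ (profileGraph n ds).sl e = 0 ∨
        ∃ i, (ds ((profileGraph n ds).hd e))[i]? = some ((profileGraph n ds).tl e) ∧
          (profileGraph n ds).sl e + i = (ds ((profileGraph n ds).hd e)).length) := by
  have h : ((profileGraph n ds).tl e, (profileGraph n ds).hd e, (profileGraph n ds).sl e) ∈
      (List.range n).flatMap fun a => agentEdges n a (ds a) := by
    have h1 : e < ((List.range n).flatMap fun a => agentEdges n a (ds a)).length := he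
    have h2 := List.getElem_mem h1
    rw [← List.getD_eq_getElem _ (0, 0, 0) h1] at h2
    exact h2
  rw [List.mem_flatMap] at h
  obtain ⟨a, ha, h⟩ := h
  rw [mem_agentEdges] at h
  obtain ⟨h1, h2⟩ := h
  rw [h1]
  exact ⟨List.mem_range.1 ha, h2⟩

theorem profileGraph_exists {t v s : ℕ} (hv : v < n)
    (h : t = n ∧ s = 0 ∨ ∃ i, (ds v)[i]? = some t ∧ s + i = (ds v).length) :
    ∃ e < (profileGraph n ds).E, (profileGraph n ds).hd e = v ∧ (profileGraph n ds).tl e = t ∧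
      (profileGraph n ds).sl e = s := by
  have h1 : (t, v, s) ∈ (List.range n).flatMap fun a => agentEdges n a (ds a) :=
    List.mem_flatMap.2 ⟨v, List.mem_range.2 hv, mem_agentEdges.2 ⟨rfl, h⟩⟩
  obtain ⟨e, he, h2⟩ := List.getElem_of_mem h1
  rw [← List.getD_eq_getElem _ (0, 0, 0) he] at h2
  exact ⟨e, he, congrArg (fun p => p.2.1) h2, congrArg Prod.fst h2, congrArg (fun p => p.2.2) h2⟩

theorem profileGraph_wf (hds : ∀ v < n, ∀ u ∈ ds v, u < n) : (profileGraph n ds).WF := by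
  refine ⟨fun e he => (profileGraph_edge he).1, fun e he => ?_, fun e he => ?_, fun v hv => ?_⟩
  · obtain ⟨h1, h2 | ⟨i, h2, h3⟩⟩ := profileGraph_edge he
    · exact h2.1.le
    · exact (hds _ h1 _ (List.mem_of_getElem? h2)).le
  · obtain ⟨h1, h2 | ⟨i, h2, h3⟩⟩ := profileGraph_edge he
    · omega
    · change _ ≤ (ds _).length + 1
      omega
  · obtain ⟨e, he, h1, h2, -⟩ := profileGraph_exists (ds := ds) hv (.inl ⟨rfl, rfl⟩)
    exact ⟨e, he, h1, h2⟩

theorem profileGraph_E : (profileGraph n ds).E = (∑ v ∈ Finset.range n, (ds v).length) + n := by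
  simp only [profileGraph, List.length_flatMap, length_agentEdges]
  rw [← List.sum_toFinset _ (List.nodup_range), List.toFinset_range, Finset.sum_add_distrib]
  simp

end profileGraph

/-- Finds an outcome of a Liquid profile under MinSum. -/
def minSumProg : Prog := .seq readProg (.seq ascentProg treeProg)

/-- Every term is at most a multiple of `n * E` because `1 ≤ n ≤ E`; here `E` will be the number of
delegations plus `n`. -/
theorem total_time_le {n E : ℕ} (hn : 1 ≤ n) (hE : n ≤ E) :
    21 * E + 10 + ((2 * n + 2) * (20 * E + 20 * n + 30) + 2 +
      (n * (10 * (2 * n) + 20) + 3)) ≤ 400 * (n * E) := by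
  nlinarith [Nat.mul_le_mul hn (le_refl E), Nat.mul_le_mul (le_refl n) hE,
    Nat.mul_le_mul hn (hn.trans hE)]

theorem phases_runs {G : EdgeData} (hG : G.WF) {M : Memory} {lab rem c vote ρ : ℕ → ℕ}
    (hM : Mem G lab rem c vote ρ 1 0 M) (hlab : lab G.n = 1) (hlab0 : ∀ v < G.n, lab v = 0)
    (hρ : ρ G.n = 1) (hρ0 : ∀ v < G.n, ρ v = 0) (hrem : ∀ v < G.n, rem v = G.cap v) :
    Runs (.seq ascentProg treeProg) M ((2 * G.n + 2) * (20 * G.E + 20 * G.n + 30) + 2 +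
      (G.n * (10 * (2 * G.n) + 20) + 3)) (fun M' => ∃ rem T c S y ρ vote' f,
        G.History rem T c S y ∧ G.Tree T c S vote G.n ρ vote' f ∧ M'.arr 1 = vote') := by
  have hunv : unvisited G lab ≤ G.n := by
    refine (Finset.card_filter_le _ _).trans ?_
    rw [Finset.card_range]
  refine Runs.seq' (ascentProg_runs hG hM (labelled_zero c hlab hlab0)
    (history_zero hG c hrem) (by omega)) ?_
  rintro M₂ ⟨lab', rem', c', S', y', T', hM', hL', hH', hT', hdone⟩
  refine (treeProg_runs hG hM' hH' (fun v hv => hL'.reach_root v hv.le (hdone v hv))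
    (by omega) hρ0).mono ?_ ?_
  · gcongr
  · rintro M₃ ⟨ρ', vote', f, hM₃, hTree⟩
    exact ⟨rem', T', c', S', y', ρ', vote', f, hH', hTree, hM₃.vote⟩

theorem minSumProg_runs {n : ℕ} (hn : 1 ≤ n) (ds : ℕ → List ℕ) (bk : ℕ → ℕ)
    (hds : ∀ v < n, ∀ u ∈ ds v, u < n) :
    Runs minSumProg (Memory.init (n :: ballotsInput ds bk (List.range n)))
      (400 * (n * (profileGraph n ds).E)) (fun M' => ∃ rem T c S y vote₀ ρ vote f,
        (profileGraph n ds).History rem T c S y ∧ (∀ v < n, vote₀ v = bk v) ∧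
        (profileGraph n ds).Tree T c S vote₀ n ρ vote f ∧ M'.arr 1 = vote) := by
  have hread := readProg_runs n ds bk
  have hG := profileGraph_wf hds
  have hGn : (profileGraph n ds).n = n := rfl
  have hE : n ≤ (profileGraph n ds).E := by rw [profileGraph_E]; exact Nat.le_add_left _ _
  generalize profileGraph n ds = G at hread hG hGn hE ⊢
  subst hGn
  refine (Runs.seq' hread ?_).mono (total_time_le hn hE) (fun _ h => h)
  rintro M₁ ⟨lab, rem, c, vote, ρ, hM, hlab, hlab0, hρ, hρ0, hrem, hvote⟩
  refine (phases_runs hG hM hlab hlab0 hρ hρ0 hrem).mono le_rfl ?_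
  rintro M₂ ⟨rem', T', c', S', y', ρ', vote', f, h1, h2, h3⟩
  exact ⟨rem', T', c', S', y', vote, ρ', vote', f, h1, hvote, h2, h3⟩

section profile

variable {n m : ℕ} {B : Profile (Fin n) (Fin m)}

theorem Profile.IsLiquid.exists_delegates (hB : B.IsLiquid) :
    ∃ D : Fin n → List (Fin n), ∀ a, (B a).delegations = (D a).map Delegation.single := by
  have : ∀ a, ∃ l : List (Fin n), (B a).delegations = l.map Delegation.single := by
    intro a
    have h := hB a
    rw [SmartBallot.IsLiquid] at h
    generalize (B a).delegations = L at h
    induction L with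
    | nil => exact ⟨[], rfl⟩
    | cons δ L ih =>
      obtain ⟨l, hl⟩ := ih (fun δ' h' => h δ' (List.mem_cons_of_mem _ h'))
      obtain ⟨b, -, hb⟩ := h δ List.mem_cons_self
      exact ⟨b :: l, by rw [List.map_cons, ← hl, hb]⟩
  choose D hD using this
  exact ⟨D, hD⟩

/-- The delegates of the agents, as natural numbers. -/
def delegatesVal (D : Fin n → List (Fin n)) (v : ℕ) : List ℕ :=
  if h : v < n then (D ⟨v, h⟩).map Fin.val else []

/-- The backup votes of the agents, as natural numbers. -/
def backupVal (B : Profile (Fin n) (Fin m)) (v : ℕ) : ℕ :=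
  if h : v < n then ((B ⟨v, h⟩).backup).val else 0

variable {D : Fin n → List (Fin n)}

theorem delegatesVal_val (a : Fin n) : delegatesVal D a.val = (D a).map Fin.val := by
  simp [delegatesVal]

theorem backupVal_val (a : Fin n) : backupVal B a.val = ((B a).backup).val := by
  simp [backupVal]

theorem encode_eq (hD : ∀ a, (B a).delegations = (D a).map Delegation.single) :
    B.encode = n :: ballotsInput (delegatesVal D) (backupVal B) (List.range n) := by
  rw [Profile.encode, ballotsInput, ← List.map_coe_finRange_eq_range, List.flatMap_map]
  congr 2
  funext a
  rw [SmartBallot.encode, delegatesVal_val, backupVal_val, hD a]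
  simp only [List.length_map]
  congr 2
  induction D a with
  | nil => rfl
  | cons b l ih => simp [ih, Delegation.single]

theorem numDelegations_eq (hD : ∀ a, (B a).delegations = (D a).map Delegation.single) :
    (profileGraph n (delegatesVal D)).E = B.numDelegations + n := by
  rw [profileGraph_E, Finset.sum_range, Profile.numDelegations]
  simp [delegatesVal_val, hD]

theorem necessaryWinner_single {N D : Type} {b : N} {X : N → Option D} {x : D}
    (h : X b = some x) : (Delegation.single b).NecessaryWinner X x :=
  fun _ hv => hv ⟨b, _⟩ x h

/-- If `b` had not voted, its vote could be completed to an alternative other than `x`. With a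
single alternative the claim fails. -/
theorem NecessaryWinner.single_eq {N D : Type} [Nontrivial D] {b : N} {X : N → Option D} {x : D}
    (h : (Delegation.single b).NecessaryWinner X x) : X b = some x := by
  cases hb : X b with
  | none =>
    obtain ⟨x', hx'⟩ := exists_ne x
    exact absurd (h (fun _ => x') (by
      rintro ⟨b', hb'⟩ y hy
      have hb'' : b' = b := Finset.mem_singleton.1 hb'
      simp only [hb'', hb] at hy
      exact absurd hy (by simp))) hx'
  | some y =>
    have := h (fun _ => y) (by
      rintro ⟨b', hb'⟩ z hz
      have hb'' : b' = b := Finset.mem_singleton.1 hb'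
      simp only [hb'', hb] at hz
      exact Option.some.inj hz)
    rw [← this]
    rfl

end profile

end SmartVoting

/-! ### Arborescences and consistent certificates. -/

namespace SmartVoting

open RAM EdgeData

variable {n m : ℕ} {B : Profile (Fin n) (Fin m)} {D : Fin n → List (Fin n)}

theorem level_single (hD : ∀ a, (B a).delegations = (D a).map Delegation.single) {a b : Fin n}
    {i : ℕ} (hi : (D a)[i]? = some b) : (B a).level (i + 1) = Sum.inl (Delegation.single b) := by
  simp [SmartBallot.level, hD, hi]

theorem level_backup (hD : ∀ a, (B a).delegations = (D a).map Delegation.single) (a : Fin n) :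
    (B a).level ((D a).length + 1) = Sum.inr (B a).backup := by
  simp [SmartBallot.level, hD]

theorem cap_profileGraph (a : Fin n) :
    (profileGraph n (delegatesVal D)).cap a = (D a).length + 1 := by
  simp [profileGraph, delegatesVal_val]

/-- The outcome of a tree. -/
theorem EdgeData.Tree.isOutcomeOf (hD : ∀ a, (B a).delegations = (D a).map Delegation.single)
    {T : ℕ} {rem c y vote₀ ρ vote f : ℕ → ℕ} {S : ℕ → Finset ℕ}
    (hH : (profileGraph n (delegatesVal D)).History rem T c S y)
    (hvote₀ : ∀ v < n, vote₀ v = backupVal B v)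
    (hT : (profileGraph n (delegatesVal D)).Tree T c S vote₀ n ρ vote f) :
    ∃ X : Fin n → Fin m, (∀ a, vote a.val = (X a).val) ∧
      IsCertificate B (fun a => (profileGraph n (delegatesVal D)).cap a -
        (profileGraph n (delegatesVal D)).sl (f a)) ∧
      IsOutcomeOf B (fun a => (profileGraph n (delegatesVal D)).cap a -
        (profileGraph n (delegatesVal D)).sl (f a)) X := by
  have hcap := cap_profileGraph (D := D)
  have hgraph := fun e => profileGraph_edge (n := n) (ds := delegatesVal D) (e := e)
  have hds := delegatesVal_val (D := D)
  have hGn : (profileGraph n (delegatesVal D)).n = n := rfl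
  generalize profileGraph n (delegatesVal D) = G at *
  subst hGn
  have hall := hT.reached
  have hedge : ∀ a : Fin G.n, (G.tl (f a) = G.n ∧ G.sl (f a) = 0 ∧ vote a = (B a).backup) ∨
      ∃ (b : Fin G.n) (i : ℕ), G.tl (f a) = b ∧ (D a)[i]? = some b ∧
        G.sl (f a) + i = (D a).length ∧ ρ b < ρ a ∧ vote a = vote b := by
    intro a
    obtain ⟨⟨t, ht, hft⟩, hhd, h⟩ := hT.edge a a.2 (hall a a.2)
    have hg := (hgraph (f a) (hft ▸ hH.edge_lt t ht)).2
    rw [hhd, hds, List.length_map] at hg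
    rcases h with ⟨h1, h2⟩ | ⟨h1, h2, h3, h4⟩
    · rcases hg with hg | ⟨i, hg, -⟩
      · exact .inl ⟨h1, hg.2, by rw [h2, hvote₀ a a.2, backupVal_val]⟩
      · rw [List.getElem?_map, Option.map_eq_some_iff] at hg
        obtain ⟨b, -, hb⟩ := hg
        have := b.2
        omega
    · rcases hg with hg | ⟨i, hg, hi⟩
      · omega
      · rw [List.getElem?_map, Option.map_eq_some_iff] at hg
        obtain ⟨b, hb, hb'⟩ := hg
        rw [← hb'] at h3 h4
        exact .inr ⟨b, i, hb'.symm, hb, hi, h3, h4⟩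
  -- Stored votes are plain numbers; following the tree back to a backup vote shows that they name
  -- alternatives.
  have hlt : ∀ k, ∀ a : Fin G.n, ρ a = k → vote a < m := by
    intro k
    induction k using Nat.strong_induction_on with
    | _ k ih =>
      intro a ha
      rcases hedge a with ⟨-, -, h⟩ | ⟨b, i, -, -, -, h1, h2⟩
      · rw [h]; exact Fin.is_lt _
      · rw [h2]; exact ih _ (ha ▸ h1) b rfl
  refine ⟨fun a => ⟨vote a, hlt _ a rfl⟩, fun _ => rfl, ?_, ?_⟩
  · intro a
    simp only [SmartBallot.numLevels, hD, List.length_map, hcap]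
    rcases hedge a with ⟨-, h, -⟩ | ⟨b, i, -, h0, h, -⟩
    · omega
    · have := (List.getElem?_eq_some_iff.1 h0).1
      omega
  · have hle := hT.le
    -- `ρ` is injective on the agents with values in `1, …, n`; shifted by one it is the required
    -- ordering.
    have hbij : Function.Bijective
        (fun a : Fin G.n => (⟨ρ a - 1, by
          have := hle a a.2
          have := hall a a.2
          rw [Fintype.card_fin]; omega⟩ : Fin (Fintype.card (Fin G.n)))) := by
      rw [Fintype.bijective_iff_injective_and_card]
      refine ⟨fun a b hab => ?_, by simp⟩
      have h1 := hall a a.2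
      have h2 := hall b b.2
      have h3 : ρ a - 1 = ρ b - 1 := congrArg Fin.val hab
      exact Fin.ext (hT.inj a a.2 b b.2 h1 (by omega))
    refine ⟨Equiv.ofBijective _ hbij, fun a => ?_⟩
    simp only [hcap, Equiv.ofBijective_apply, Fin.mk_lt_mk]
    rcases hedge a with ⟨-, h1, h2⟩ | ⟨b, i, -, h0, h1, h2, h3⟩
    · rw [h1, Nat.sub_zero, level_backup hD]
      exact Fin.ext h2
    · have : (D a).length + 1 - G.sl (f a) = i + 1 := by omega
      simp only [this, level_single hD h0, LevelDetermines]
      have := hall b b.2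
      have := hall a a.2
      refine necessaryWinner_single ?_
      rw [if_pos (by omega)]
      simp only [h3]

/-- A consistent certificate is an arborescence. -/
theorem IsOutcomeOf.exists_edges [Nontrivial (Fin m)]
    (hD : ∀ a, (B a).delegations = (D a).map Delegation.single) {c : Fin n → ℕ}
    (hc : IsCertificate B c) {X : Fin n → Fin m} (hX : IsOutcomeOf B c X) :
    ∃ g τ : ℕ → ℕ, (∀ v < n, g v < (profileGraph n (delegatesVal D)).E ∧
      (profileGraph n (delegatesVal D)).hd (g v) = v ∧
      ((profileGraph n (delegatesVal D)).tl (g v) = n ∨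
        (profileGraph n (delegatesVal D)).tl (g v) < n ∧
          τ ((profileGraph n (delegatesVal D)).tl (g v)) < τ v)) ∧
      ∀ a : Fin n, (profileGraph n (delegatesVal D)).cap a -
        (profileGraph n (delegatesVal D)).sl (g a) = c a := by
  obtain ⟨σ, hσ⟩ := hX
  have key : ∀ a : Fin n, ∃ e < (profileGraph n (delegatesVal D)).E,
      (profileGraph n (delegatesVal D)).hd e = a ∧
      ((profileGraph n (delegatesVal D)).tl e = n ∨
        ∃ b : Fin n, (profileGraph n (delegatesVal D)).tl e = b ∧ σ b < σ a) ∧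
      (profileGraph n (delegatesVal D)).cap a - (profileGraph n (delegatesVal D)).sl e = c a := by
    intro a
    have hca := hc a
    rw [SmartBallot.numLevels, hD, List.length_map] at hca
    rw [cap_profileGraph]
    rcases hca.2.eq_or_lt with h | h
    · obtain ⟨e, he, h1, h2, h3⟩ := profileGraph_exists (ds := delegatesVal D) a.2 (.inl ⟨rfl, rfl⟩)
      exact ⟨e, he, h1, .inl h2, by rw [h3, h]; rfl⟩
    · have hlt : c a - 1 < (D a).length := by omega
      have hget : (D a)[c a - 1]? = some ((D a)[c a - 1]) := List.getElem?_eq_getElem hlt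
      obtain ⟨e, he, h1, h2, h3⟩ := profileGraph_exists (ds := delegatesVal D)
        (t := ((D a)[c a - 1]).val) (s := (D a).length - (c a - 1)) a.2
        (.inr ⟨c a - 1, by simp [delegatesVal_val, hget], by
          rw [delegatesVal_val, List.length_map]; omega⟩)
      refine ⟨e, he, h1, .inr ⟨_, h2, ?_⟩, by omega⟩
      have hlev := level_single hD hget
      have ha := hσ a
      rw [Nat.sub_add_cancel hca.1] at hlev
      simp only [hlev, LevelDetermines] at ha
      have ha' := NecessaryWinner.single_eq ha
      by_contra hno
      rw [if_neg hno] at ha'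
      exact absurd ha' (by simp)
  choose e he hhd htl hcost using key
  -- `τ` is the position in the ordering: a delegate votes before its delegator. The values `0`
  -- beyond the agents play no role.
  refine ⟨fun v => if h : v < n then e ⟨v, h⟩ else 0,
    fun v => if h : v < n then (σ ⟨v, h⟩).val else 0, fun v hv => ?_, fun a => ?_⟩
  · simp only [hv, dif_pos]
    refine ⟨he _, hhd _, (htl ⟨v, hv⟩).imp id ?_⟩
    rintro ⟨b, hb, hlt⟩
    simpa [hb] using hlt
  · simpa using hcost a

/-- The certificate of all backup votes is consistent, and ranks are well-founded. -/
theorem MinSum_nonempty (B : Profile (Fin n) (Fin m)) : (MinSum B).Nonempty := by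
  have hne : (consistentCertificates B).Nonempty := by
    refine ⟨fun a => (B a).numLevels, fun a => ⟨by simp [SmartBallot.numLevels], le_rfl⟩,
      fun a => (B a).backup, Fintype.equivFin _, fun a => ?_⟩
    simp [SmartBallot.level, SmartBallot.numLevels, LevelDetermines]
  have hwf := WellFounded.has_min (measure (rank (N := Fin n))).wf _ hne
  obtain ⟨c, hc, hmin⟩ := hwf
  obtain ⟨X, hX⟩ := hc.2
  exact ⟨X, c, hc, fun c' hc' => not_lt.1 (hmin c' hc'), hX⟩

end SmartVoting

theorem mainTheorem3 :
    ∃ (P : RAM.Prog) (C : ℕ),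
      ∀ (n m : ℕ) (B : SmartVoting.Profile (Fin n) (Fin m)), 1 ≤ n → B.IsLiquid →
        ∃ (t : ℕ) (M : RAM.Memory) (X : Fin n → Fin m),
          RAM.Exec P (RAM.Memory.init B.encode) t M ∧
          SmartVoting.StoresOutcome M X ∧
          X ∈ SmartVoting.MinSum B ∧
          t ≤ C * (n * (B.numDelegations + n)) := by
  refine ⟨SmartVoting.minSumProg, 400, fun n m B hn hB => ?_⟩
  obtain ⟨D, hD⟩ := SmartVoting.Profile.IsLiquid.exists_delegates hB
  have hds : ∀ v < n, ∀ u ∈ SmartVoting.delegatesVal D v, u < n := by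
    intro v hv u hu
    rw [SmartVoting.delegatesVal, dif_pos hv, List.mem_map] at hu
    obtain ⟨b, -, rfl⟩ := hu
    exact b.2
  obtain ⟨t, M, hexec, ht, rem, T, c, S, y, vote₀, ρ, vote, f, hH, hvote₀, hT, hM⟩ :=
    SmartVoting.minSumProg_runs hn (SmartVoting.delegatesVal D) (SmartVoting.backupVal B) hds
  rw [SmartVoting.numDelegations_eq hD] at ht
  rw [← SmartVoting.encode_eq hD] at hexec
  obtain ⟨X, hX, hcert, hout⟩ := SmartVoting.EdgeData.Tree.isOutcomeOf hD hH hvote₀ hT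
  refine ⟨t, M, X, hexec, fun a => by rw [hM, hX], ?_, ht⟩
  -- With one alternative even cyclic delegations are consistent, so the tree need not have minimum
  -- rank; but there is only one outcome vector.
  rcases subsingleton_or_nontrivial (Fin m) with hm | hm
  · obtain ⟨X', hX'⟩ := SmartVoting.MinSum_nonempty B
    rwa [Subsingleton.elim X X']
  · refine ⟨_, ⟨hcert, X, hout⟩, ?_, hout⟩
    rintro c' ⟨hc', X', hX'⟩
    obtain ⟨g, τ, hg, hgc⟩ := hX'.exists_edges hD hc'
    have := hT.weight_le hH hg
    rw [show (SmartVoting.profileGraph n (SmartVoting.delegatesVal D)).n = n from rfl,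
      Finset.sum_range, Finset.sum_range] at this
    simpa only [SmartVoting.rank, hgc] using this
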